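/- Let $M,F$ be smooth manifolds (finite-dimensional, without boundary, Hausdorff, second countable) and let $\pi:F\to M$ be a smooth fibre bundle with typical fibre a smooth manifold $N$. Let $k\in\mathbb N$ and let $W$ be a Weil algebra, i.e. a finite-dimensional commutative $\mathbb R$-algebra with $W=\mathbb R\cdot 1\oplus V$, $1\neq 0$, where $V$ consists of nilpotent elements; write $\mathbb D$ for the infinitesimally thickened point with $\mathcal O(\mathbb D)=W$, and $\mathbb D^1(1)$ for the one with $\mathcal O(\mathbb D^1(1))=\mathbb R[\epsilon]/\epsilon^2$. For a Cartesian space $P$ and a Weil algebra $W'=\mathcal O(\mathbb D')$, a $P\times\mathbb D'$-plot of the field space $\mathcal F=\Gamma_M(F)$ is a map $\phi:P\times\mathbb D'\times M\to F$ with $\pi\circ\phi=p_M$, that is, the formal dual of an $\mathbb R$-algebra homomorphism $\phi^*:C^\infty(F)\to C^\infty(M\times P)\otimes W'$ with $\phi^*\circ\pi^*=p_M^*$, where $p_M^*h=(h\circ \mathrm{pr}_M)\otimes 1$. A $P\times\mathbb D'$-plot of $\Gamma_M(VF)$, where $VF=\ker T\pi$ is the vertical bundle, is a map $\mathcal Z:P\times\mathbb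 D'\times M\to TF$ with $T\pi\circ\mathcal Z=0_M\circ p_M$ ($0_M:M\to TM$ the zero section), again the formal dual of a homomorphism $\mathcal Z^*:C^\infty(TF)\to C^\infty(M\times P)\otimes W'$ with $\mathcal Z^*\circ(T\pi)^*=p_M^*\circ 0_M^*$; it covers the plot of fields $\pi_F\circ\mathcal Z$, where $\pi_F:TF\to F$ is the projection. The $\mathbb R^k\times\mathbb D$-plots of the synthetic tangent bundle $T\mathcal F=[\mathbb D^1(1),\mathcal F]$ are the $\mathbb R^k\times\mathbb D^1(1)\times\mathbb D$-plots of $\mathcal F$. A path of plots is an $\mathbb R^k\times\mathbb D\times\mathbb R^1_t$-plot $\phi_t$ of $\mathcal F$, with restriction $\phi_0$ to $t=0$. One writes $\partial_t\phi_t|_{t=0}=\mathcal Z$ for an $\mathbb R^k\times\mathbb D$-plot $\mathcal Z$ of $\Gamma_M(VF)$ if $\pi_F\circ\mathcal Z=\phi_0$ and, for all $f\in C^\infty(F)$, $\mathcal Z^*(df)=\partial_t(\phi_t^*f)|_{t=0}$, where $df$ is viewed as a function on $TF$ and $\partial_t|_{t=0}$ acts pointwise on $C^\infty(M\times\mathbb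 R^k\times\mathbb R_t)\otimes W$. Then: 1. For every $\mathbb R^k\times\mathbb D$-plot of tangent vectors $\mathcal Z\in\Gamma_M(VF)(\mathbb R^k\times\mathbb D)$, covering $\phi=\pi_F\circ\mathcal Z$, there is a path of plots $\phi_t\in\mathcal F(\mathbb R^k\times\mathbb D\times\mathbb R^1_t)$ with $\phi_0=\phi$ and $\partial_t\phi_t|_{t=0}=\mathcal Z$. 2. For every path of plots $\phi_t$ there is exactly one plot $\mathcal Z$ with $\partial_t\phi_t|_{t=0}=\mathcal Z$. Hence $\phi_t\mapsto\partial_t\phi_t|_{t=0}$ is a well-defined map $\Gamma_M(F)(\mathbb R^k\times\mathbb D\times\mathbb R^1_t)\to\Gamma_M(VF)(\mathbb R^k\times\mathbb D)$, and by 1 it is surjective. 3. The map from paths of fields to $T\mathcal F$ is plotwise surjective: the restriction $\iota_0^*:\mathcal F(\mathbb R^k\times\mathbb D\times\mathbb R^1_t)\to T\mathcal F(\mathbb R^k\times\mathbb D)$ along $\iota_0:\mathbb D^1(1)\hookrightarrow\mathbb R^1_t$, which is dual to $f\mapsto f|_{t=0}+\epsilon\,\partial_tf|_{t=0}$, is surjective.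 -/

import Mathlib

open scoped Manifold ContDiff TensorProduct

noncomputable section

/-! ### Smooth function algebras and pullbacks -/

section Pullback

variable {E H X E' H' Y E'' H'' Z : Type*}
  [NormedAddCommGroup E] [NormedSpace ℝ E] [TopologicalSpace H] {I : ModelWithCorners ℝ E H}
  [TopologicalSpace X] [ChartedSpace H X]
  [NormedAddCommGroup E'] [NormedSpace ℝ E'] [TopologicalSpace H'] {I' : ModelWithCorners ℝ E' H'}
  [TopologicalSpace Y] [ChartedSpace H' Y]
  [NormedAddCommGroup E''] [NormedSpace ℝ E''] [TopologicalSpace H'']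
  {I'' : ModelWithCorners ℝ E'' H''} [TopologicalSpace Z] [ChartedSpace H'' Z]

/-- The `ℝ`-algebra `C^∞(X)` of smooth real functions on a manifold. -/
abbrev SmoothFun (I : ModelWithCorners ℝ E H) (X : Type*) [TopologicalSpace X]
    [ChartedSpace H X] : Type _ :=
  C^∞⟮I, X; 𝓘(ℝ, ℝ), ℝ⟯

/-- The algebra map `g^* : C^∞(Y) → C^∞(X)`, `f ↦ f ∘ g`, of a smooth map `g : X → Y`. -/
def pullback (g : C^∞⟮I, X; I', Y⟯) : SmoothFun I' Y →ₐ[ℝ] SmoothFun I X where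
  toFun f := f.comp g
  map_one' := rfl
  map_mul' _ _ := rfl
  map_zero' := rfl
  map_add' _ _ := rfl
  commutes' _ := rfl

@[simp] theorem pullback_apply (g : C^∞⟮I, X; I', Y⟯) (f : SmoothFun I' Y) (x : X) :
    pullback g f x = f (g x) := rfl

theorem pullback_comp (g : C^∞⟮I, X; I', Y⟯) (h : C^∞⟮I', Y; I'', Z⟯) :
    (pullback g).comp (pullback h) = pullback (h.comp g) := rfl

end Pullback

/-! ### Weil algebras, fibre bundles, tangent bundles -/

/-- A commutative `ℝ`-algebra is a Weil algebra (the function algebra of an infinitesimally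
thickened point) if it is finite dimensional and `W = ℝ ⊕ V` as a vector space, where `ℝ` is
the line of the unit and `V` consists of nilpotent elements. -/
class IsWeilAlgebra (W : Type*) [CommRing W] [Algebra ℝ W] : Prop where
  nontrivial : Nontrivial W
  finite : Module.Finite ℝ W
  exists_isCompl : ∃ V : Submodule ℝ W, IsCompl (ℝ ∙ (1 : W)) V ∧ ∀ v ∈ V, IsNilpotent v

section Bundles

variable {m n p : ℕ}
  {M : Type*} [TopologicalSpace M] [ChartedSpace (EuclideanSpace ℝ (Fin m)) M]
  {F : Type*} [TopologicalSpace F] [ChartedSpace (EuclideanSpace ℝ (Fin p)) F]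

/-- The smooth map `π : F → M` is a smooth fibre bundle with typical fibre `N`: each point of
`M` has an open neighbourhood `U` with a diffeomorphism `π⁻¹(U) ≅ U × N` over `U`. -/
def IsSmoothFiberBundle (n : ℕ) (N : Type*) [TopologicalSpace N]
    [ChartedSpace (EuclideanSpace ℝ (Fin n)) N] (π : C^∞⟮𝓡 p, F; 𝓡 m, M⟯) : Prop :=
  ∀ x : M, ∃ e : Bundle.Trivialization N (π : F → M), x ∈ e.baseSet ∧
    ContMDiffOn (𝓡 p) ((𝓡 m).prod (𝓡 n)) ∞ e e.source ∧
    ContMDiffOn ((𝓡 m).prod (𝓡 n)) (𝓡 p) ∞ e.toOpenPartialHomeomorph.symm e.target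

variable [IsManifold (𝓡 m) ∞ M] [IsManifold (𝓡 p) ∞ F]

variable (m M) in
/-- The projection `TM → M`. -/
def tangentProj : C^∞⟮(𝓡 m).tangent, TangentBundle (𝓡 m) M; 𝓡 m, M⟯ :=
  ⟨fun v => v.1, Bundle.contMDiff_proj _⟩

variable (m M) in
/-- The zero section `0_M : M → TM`. -/
def tangentZero : C^∞⟮𝓡 m, M; (𝓡 m).tangent, TangentBundle (𝓡 m) M⟯ :=
  ⟨Bundle.zeroSection _ _, Bundle.contMDiff_zeroSection ℝ _⟩

/-- The differential `Tπ : TF → TM` of a smooth map. -/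
def tangentDiff (π : C^∞⟮𝓡 p, F; 𝓡 m, M⟯) :
    C^∞⟮(𝓡 p).tangent, TangentBundle (𝓡 p) F; (𝓡 m).tangent, TangentBundle (𝓡 m) M⟯ :=
  ⟨tangentMap (𝓡 p) (𝓡 m) π, π.contMDiff.contMDiff_tangentMap (by simp)⟩

/-- The differential of a smooth function `f`, as the function `v ↦ df(v)` on `TM`. -/
def dFun (f : SmoothFun (𝓡 m) M) : SmoothFun (𝓡 m).tangent (TangentBundle (𝓡 m) M) :=
  ⟨fun v => mfderiv (𝓡 m) 𝓘(ℝ, ℝ) f v.1 v.2,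
    (contMDiff_snd_tangentBundle_modelSpace ℝ 𝓘(ℝ, ℝ)).comp
      (f.contMDiff.contMDiff_tangentMap (m := ∞) (by simp))⟩

end Bundles

/-! ### Restriction to `t = 0`, `t`-derivative at `0`, restriction to the infinitesimal line -/

section Time

variable (m : ℕ) (M : Type*) [TopologicalSpace M] [ChartedSpace (EuclideanSpace ℝ (Fin m)) M]
  (P : Type*) [NormedAddCommGroup P] [NormedSpace ℝ P]

/-- The algebra `C^∞(M × P)` for a Cartesian space `P`. -/
abbrev ParamFun : Type _ := SmoothFun ((𝓡 m).prod 𝓘(ℝ, P)) (M × P)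

/-- The projection `M × P → M`. -/
def projM : C^∞⟮(𝓡 m).prod 𝓘(ℝ, P), M × P; 𝓡 m, M⟯ := ⟨Prod.fst, contMDiff_fst⟩

/-- The inclusion `M × P → M × (P × ℝ)` at `t = 0`. -/
def inclZero :
    C^∞⟮(𝓡 m).prod 𝓘(ℝ, P), M × P; (𝓡 m).prod 𝓘(ℝ, P × ℝ), M × (P × ℝ)⟯ :=
  ⟨fun y => (y.1, (y.2, 0)),
    contMDiff_fst.prodMk (((contDiff_id.prodMk contDiff_const).contMDiff).comp contMDiff_snd)⟩

/-- The restriction `f ↦ f|_{t=0}`. -/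
def evalZero : ParamFun m M (P × ℝ) →ₐ[ℝ] ParamFun m M P := pullback (inclZero m M P)

variable {m M P}

theorem contMDiff_line (y : M × P) :
    ContMDiff 𝓘(ℝ, ℝ) ((𝓡 m).prod 𝓘(ℝ, P × ℝ)) ∞
      (fun t : ℝ => ((y.1, (y.2, t)) : M × (P × ℝ))) :=
  contMDiff_const.prodMk (contDiff_const.prodMk contDiff_id).contMDiff

theorem differentiable_line (f : ParamFun m M (P × ℝ)) (y : M × P) :
    Differentiable ℝ (fun t : ℝ => f (y.1, (y.2, t))) :=
  ((f.contMDiff.comp (contMDiff_line y)).contDiff).differentiable (by simp)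

@[simp] theorem evalZero_apply (f : ParamFun m M (P × ℝ)) (y : M × P) :
    evalZero m M P f y = f (y.1, (y.2, 0)) := rfl

variable [IsManifold (𝓡 m) ∞ M]

theorem contMDiff_tDeriv (f : ParamFun m M (P × ℝ)) :
    ContMDiff ((𝓡 m).prod 𝓘(ℝ, P)) 𝓘(ℝ, ℝ) ∞
      (fun y : M × P => deriv (fun t : ℝ => f (y.1, (y.2, t))) 0) := by
  intro y₀
  have hpt : ContMDiff (((𝓡 m).prod 𝓘(ℝ, P)).prod 𝓘(ℝ, ℝ)) 𝓘(ℝ, P × ℝ) ∞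
      (fun q : (M × P) × ℝ => (q.1.2, q.2)) := by
    rw [contMDiff_prod_module_iff]
    exact ⟨contMDiff_snd.comp contMDiff_fst, contMDiff_snd⟩
  have hmap : ContMDiff (((𝓡 m).prod 𝓘(ℝ, P)).prod 𝓘(ℝ, ℝ)) 𝓘(ℝ, ℝ) ∞
      (Function.uncurry fun (y : M × P) (t : ℝ) => f (y.1, (y.2, t))) :=
    f.contMDiff.comp ((contMDiff_fst.comp contMDiff_fst).prodMk hpt)
  have h := ContMDiffAt.mfderiv (m := ∞) (n := ∞) (x₀ := y₀)
    (fun (y : M × P) (t : ℝ) => f (y.1, (y.2, t))) (fun _ => (0 : ℝ))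
    (hmap _) contMDiffAt_const (by simp)
  have h2 := h.clm_apply (contMDiffAt_const (c := (1 : ℝ)))
  refine h2.congr_of_eventuallyEq (Filter.Eventually.of_forall fun y => ?_)
  have e := congrFun (inTangentCoordinates_model_space (I := 𝓘(ℝ, ℝ)) (I' := 𝓘(ℝ, ℝ))
    (fun _ : M × P => (0 : ℝ)) (fun x => f (x.1, (x.2, 0)))
    (fun x => mfderiv 𝓘(ℝ, ℝ) 𝓘(ℝ, ℝ) (fun t : ℝ => f (x.1, (x.2, t))) 0) y₀) y
  have e' := congrArg (fun L : ℝ →L[ℝ] ℝ => L 1) e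
  refine Eq.trans ?_ e'.symm
  simp only [mfderiv_eq_fderiv]
  rfl

/-- The `t`-derivative at `t = 0`, `f ↦ ∂_t f|_{t=0}`, pointwise over `M × P`. -/
def tDeriv : ParamFun m M (P × ℝ) →ₗ[ℝ] ParamFun m M P where
  toFun f := ⟨fun y => deriv (fun t : ℝ => f (y.1, (y.2, t))) 0, contMDiff_tDeriv f⟩
  map_add' f g := by
    ext y
    exact deriv_fun_add (differentiable_line f y 0) (differentiable_line g y 0)
  map_smul' c f := by
    ext y
    exact deriv_const_smul_field c (fun t : ℝ => f (y.1, (y.2, t)))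

@[simp] theorem tDeriv_apply (f : ParamFun m M (P × ℝ)) (y : M × P) :
    tDeriv f y = deriv (fun t : ℝ => f (y.1, (y.2, t))) 0 := rfl

theorem tDeriv_mul (f g : ParamFun m M (P × ℝ)) :
    tDeriv (f * g) = tDeriv f * evalZero m M P g + evalZero m M P f * tDeriv g := by
  ext y
  exact deriv_fun_mul (differentiable_line f y 0) (differentiable_line g y 0)

variable (m M P) in
/-- Restriction along the infinitesimal line `ι₀ : 𝔻¹(1) → ℝ`, whose function algebra is
`ℝ[ε]/ε²`: the algebra map `f ↦ f|_{t=0} + ε ∂_t f|_{t=0}`. -/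
def taylor : ParamFun m M (P × ℝ) →ₐ[ℝ] ParamFun m M P ⊗[ℝ] DualNumber ℝ :=
  AlgHom.ofLinearMap
    ((TensorProduct.mk ℝ (ParamFun m M P) (DualNumber ℝ)).flip 1 ∘ₗ (evalZero m M P).toLinearMap +
      (TensorProduct.mk ℝ (ParamFun m M P) (DualNumber ℝ)).flip DualNumber.eps ∘ₗ tDeriv)
    (by
      have h : tDeriv (1 : ParamFun m M (P × ℝ)) = 0 := by
        ext y
        exact deriv_const 0 (1 : ℝ)
      simp [h, Algebra.TensorProduct.one_def])
    (by
      intro f g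
      simp [tDeriv_mul, add_mul, mul_add]
      abel)

theorem taylor_projM (h : SmoothFun (𝓡 m) M) :
    taylor m M P (pullback (projM m M (P × ℝ)) h) = pullback (projM m M P) h ⊗ₜ[ℝ] 1 := by
  have h0 : tDeriv (pullback (projM m M (P × ℝ)) h) = (0 : ParamFun m M P) := by
    ext y
    exact deriv_const 0 (h y.1)
  have h1 : evalZero m M P (pullback (projM m M (P × ℝ)) h) = pullback (projM m M P) h := rfl
  simp [taylor, h0, h1]

end Time

/-! ### Plots of fields, of vertical fields, and paths of plots -/

section Plots

variable {m p : ℕ}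
  {M : Type*} [TopologicalSpace M] [ChartedSpace (EuclideanSpace ℝ (Fin m)) M]
  {F : Type*} [TopologicalSpace F] [ChartedSpace (EuclideanSpace ℝ (Fin p)) F]

variable (m M) in
/-- The algebra map `p_M^* : C^∞(M) → C^∞(M × P) ⊗ W` of the projection onto `M`. -/
def projPullback (P : Type*) [NormedAddCommGroup P] [NormedSpace ℝ P]
    (W : Type*) [CommRing W] [Algebra ℝ W] : SmoothFun (𝓡 m) M →ₐ[ℝ] ParamFun m M P ⊗[ℝ] W :=
  Algebra.TensorProduct.includeLeft.comp (pullback (projM m M P))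

/-- A plot of the field space `Γ_M(F)` with probe `P × 𝔻`, where `W = 𝒪(𝔻)`: an algebra map
`φ^* : C^∞(F) → C^∞(M × P) ⊗ W` with `φ^* ∘ π^* = p_M^*`, that is, the formal dual of a map
`φ : P × 𝔻 × M → F` with `π ∘ φ = p_M`. -/
@[ext] structure FieldPlot (π : C^∞⟮𝓡 p, F; 𝓡 m, M⟯)
    (P : Type*) [NormedAddCommGroup P] [NormedSpace ℝ P]
    (W : Type*) [CommRing W] [Algebra ℝ W] where
  hom : SmoothFun (𝓡 p) F →ₐ[ℝ] ParamFun m M P ⊗[ℝ] W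
  hom_comp : hom.comp (pullback π) = projPullback m M P W

/-- The field plots with probe `P × 𝔻 × 𝔻¹(1)`, that is, the `P × 𝔻`-plots of the synthetic
tangent bundle `[𝔻¹(1), Γ_M(F)]`. -/
abbrev TangentPlot (π : C^∞⟮𝓡 p, F; 𝓡 m, M⟯)
    (P : Type*) [NormedAddCommGroup P] [NormedSpace ℝ P]
    (W : Type*) [CommRing W] [Algebra ℝ W] : Type _ :=
  FieldPlot π P (DualNumber ℝ ⊗[ℝ] W)

/-- The paths of plots: field plots with probe `P × 𝔻 × ℝ_t`. -/
abbrev PathPlot (π : C^∞⟮𝓡 p, F; 𝓡 m, M⟯)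
    (P : Type*) [NormedAddCommGroup P] [NormedSpace ℝ P]
    (W : Type*) [CommRing W] [Algebra ℝ W] : Type _ :=
  FieldPlot π (P × ℝ) W

variable {π : C^∞⟮𝓡 p, F; 𝓡 m, M⟯} {P : Type*} [NormedAddCommGroup P] [NormedSpace ℝ P]
  {W : Type*} [CommRing W] [Algebra ℝ W]

/-- The restriction `φ_0` of a path of plots to `t = 0`. -/
def FieldPlot.atZero (Φ : PathPlot π P W) : FieldPlot π P W where
  hom := (Algebra.TensorProduct.map (evalZero m M P) (AlgHom.id ℝ W)).comp Φ.hom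
  hom_comp := by
    rw [AlgHom.comp_assoc, Φ.hom_comp]
    ext f
    simp [projPullback]
    rfl

variable [IsManifold (𝓡 m) ∞ M]

/-- The restriction of a path of plots along `id × ι₀ : P × 𝔻 × 𝔻¹(1) → P × 𝔻 × ℝ_t`. -/
def FieldPlot.restrictInfinitesimal (Φ : PathPlot π P W) : TangentPlot π P W where
  hom := (Algebra.TensorProduct.assoc ℝ ℝ ℝ (ParamFun m M P) (DualNumber ℝ) W).toAlgHom.comp
    ((Algebra.TensorProduct.map (taylor m M P) (AlgHom.id ℝ W)).comp Φ.hom)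
  hom_comp := by
    rw [AlgHom.comp_assoc, AlgHom.comp_assoc, Φ.hom_comp]
    refine AlgHom.ext fun h => ?_
    simp [projPullback, taylor_projM, Algebra.TensorProduct.one_def]

variable [IsManifold (𝓡 p) ∞ F]

/-- A plot of `Γ_M(VF)` with probe `P × 𝔻`, where `VF` is the vertical bundle, the pullback of
`Tπ : TF → TM` along the zero section `0_M : M → TM`: the formal dual of a map
`Z : P × 𝔻 × M → TF` with `Tπ ∘ Z = 0_M ∘ p_M`. -/
@[ext] structure VerticalPlot (π : C^∞⟮𝓡 p, F; 𝓡 m, M⟯)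
    (P : Type*) [NormedAddCommGroup P] [NormedSpace ℝ P]
    (W : Type*) [CommRing W] [Algebra ℝ W] where
  hom : SmoothFun (𝓡 p).tangent (TangentBundle (𝓡 p) F) →ₐ[ℝ] ParamFun m M P ⊗[ℝ] W
  hom_comp : hom.comp (pullback (tangentDiff π)) =
    (projPullback m M P W).comp (pullback (tangentZero m M))

/-- The plot of fields `π_F ∘ Z` that a plot `Z` of tangent vectors covers. -/
def VerticalPlot.base (Z : VerticalPlot π P W) : FieldPlot π P W where
  hom := Z.hom.comp (pullback (tangentProj p F))
  hom_comp := by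
    have h : (pullback (tangentProj p F)).comp (pullback π) =
        (pullback (tangentDiff π)).comp (pullback (tangentProj m M)) := rfl
    have h' : (pullback (tangentZero m M)).comp (pullback (tangentProj m M)) =
        AlgHom.id ℝ _ := rfl
    rw [AlgHom.comp_assoc, h, ← AlgHom.comp_assoc, Z.hom_comp, AlgHom.comp_assoc, h',
      AlgHom.comp_id]



/-- The relation `∂_t φ_t|_{t=0} = Z`, the derivative being computed pointwise over `M`: the
plot `Z` of tangent vectors has base `φ_0`, and for each smooth function `f` on `F` it sends
the function `df` on `TF` to `∂_t (f ∘ φ_t)|_{t=0}`. -/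
def FieldPlot.HasTDerivAtZero (Φ : PathPlot π P W) (Z : VerticalPlot π P W) : Prop :=
  Z.base = Φ.atZero ∧
    ∀ f : SmoothFun (𝓡 p) F, Z.hom (dFun f) = tDeriv.rTensor W (Φ.hom f)

end Plots

end

/-!
A plot with values in `C^∞(Y) ⊗ W`, where `Y = M × P`, is the same as a family, smooth in `y : Y`,
of algebra homomorphisms to the Weil algebra `W`, obtained by evaluation at the points of `Y`
(`exists_algHom_of_family`, `pointEvalW_ext`). So the proof is about homomorphisms
`C^∞(X) → W`, the `W`-valued points of a manifold `X`, and their dependence on parameters.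

Such a point lies over a real point of `X`, since by Milnor's exercise (`exists_eval_of_algHom`) the
characters of `C^∞(X)` are evaluations. As the kernel of `W → ℝ` is nilpotent, it sees only the
germs of functions at the real point, and the questions become questions about a vector space. There
Hadamard's lemma, applied once for each power of the nilpotent ideal, shows that a `W`-valued point
is determined by its coordinates (`algHom_linear_ext`), that derivations obey the chain rule
(`derivation_linear_chain_rule`), and that a family of points is smooth as soon as its coordinates
are (`weakSmoothAt_family_linear`). Points with arbitrary coordinates come from translation by
the exponential of a nilpotent derivation (`exists_algHom_linear`).

For `X = TF` this says that a `W`-valued point of `TF` is the same as a `W`-valued point `a` of `F`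
together with a derivation `b` along `a`; the two are its values on the functions `f ∘ π_F` and `df`
(`algHom_tangent_ext`, `exists_algHom_tangent`). Hence a plot of vertical fields is a plot of fields
with a derivation along it that kills the functions from `M` (`exists_verticalPlot`). The derivative
`∂_t|_{t=0}` of a path of plots is such a derivation, so it is a plot of vertical fields, and the
only one with the required values.

For the existence of paths there is a smooth map `Ex : TF × ℝ → F` such that `t ↦ Ex (v, t)` stays
in a fibre of `F`, starts at the base point of `v`, and has initial velocity `v` if `v` is vertical
(`exists_vertical_curves`). It is the composite of the displacements by `t ρ_i v` in local
trivializations, for a partition of unity `ρ_i`, so that neither a metric nor the flow of a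
differential equation is needed. Given a plot `Z` of vertical fields, the path is
`φ_t^* f = Z^* (f ∘ Ex (·, t))`.

A plot of the synthetic tangent bundle is `a + ε b` with a plot `a` of fields and a derivation `b`
along `a`, that is, a plot of vertical fields again; a path with this velocity restricts to it.
-/

open Set Filter Topology

/-! ### Hadamard's lemma with smooth remainder -/

section Hadamard

variable {V : Type*} [NormedAddCommGroup V] [NormedSpace ℝ V] [FiniteDimensional ℝ V]

theorem hasFDerivAt_integral_param {f : V × ℝ → ℝ} (hf : ContDiff ℝ ∞ f) (x : V) :
    HasFDerivAt (fun x => ∫ s in (0 : ℝ)..1, f (x, s))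
      (∫ s in (0 : ℝ)..1, (fderiv ℝ f (x, s)).comp (ContinuousLinearMap.inl ℝ V ℝ)) x := by
  have hc : Continuous f := hf.continuous
  have hc' : Continuous fun q : V × ℝ =>
      (fderiv ℝ f q).comp (ContinuousLinearMap.inl ℝ V ℝ) :=
    (hf.continuous_fderiv (by simp)).clm_comp continuous_const
  obtain ⟨C, hC⟩ := ((isCompact_closedBall x (1 : ℝ)).prod
    (isCompact_Icc (a := (0 : ℝ)) (b := 1))).exists_bound_of_continuousOn hc'.continuousOn
  refine intervalIntegral.hasFDerivAt_integral_of_dominated_of_fderiv_le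
    (F := fun x s => f (x, s))
    (F' := fun x s => (fderiv ℝ f (x, s)).comp (ContinuousLinearMap.inl ℝ V ℝ))
    (bound := fun _ => C) (Metric.closedBall_mem_nhds x one_pos)
    (Eventually.of_forall fun y => Continuous.aestronglyMeasurable (by fun_prop))
    (Continuous.intervalIntegrable (by fun_prop) _ _)
    (Continuous.aestronglyMeasurable (hc'.comp (by fun_prop)))
    (Eventually.of_forall fun t ht y hy => ?_) (by simp)
    (Eventually.of_forall fun t _ y _ => ?_)
  · rw [uIoc_of_le zero_le_one] at ht
    exact hC (y, t) ⟨hy, ht.1.le, ht.2⟩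
  · have h1 : HasFDerivAt f (fderiv ℝ f (y, t)) (y, t) :=
      (hf.differentiable (by simp)).differentiableAt.hasFDerivAt
    have h2 : HasFDerivAt (fun z : V => (z, t)) (ContinuousLinearMap.inl ℝ V ℝ) y :=
      hasFDerivAt_prodMk_left y t
    exact h1.comp y h2

theorem contDiff_integral_param {f : V × ℝ → ℝ} (hf : ContDiff ℝ ∞ f) :
    ContDiff ℝ ∞ (fun x => ∫ s in (0 : ℝ)..1, f (x, s)) := by
  rw [contDiff_infty]
  intro n
  induction n generalizing f with
  | zero =>
    exact contDiff_zero.2 (continuous_iff_continuousAt.2 fun x =>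
      (hasFDerivAt_integral_param hf x).continuousAt)
  | succ n ih =>
    push_cast
    rw [contDiff_succ_iff_fderiv_apply]
    refine ⟨fun x => (hasFDerivAt_integral_param hf x).differentiableAt, by simp, fun v => ?_⟩
    have hc' : Continuous fun q : V × ℝ =>
        (fderiv ℝ f q).comp (ContinuousLinearMap.inl ℝ V ℝ) :=
      (hf.continuous_fderiv (by simp)).clm_comp continuous_const
    have h : ∀ x, fderiv ℝ (fun x => ∫ s in (0 : ℝ)..1, f (x, s)) x v =
        ∫ s in (0 : ℝ)..1, fderiv ℝ f (x, s) (v, 0) := by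
      intro x
      rw [(hasFDerivAt_integral_param hf x).fderiv, ContinuousLinearMap.intervalIntegral_apply]
      · simp
      · exact Continuous.intervalIntegrable (hc'.comp (by fun_prop)) _ _
    simp_rw [h]
    exact ih ((hf.fderiv_right (m := ∞) (by simp)).clm_apply contDiff_const)

/-- Hadamard's lemma on a finite-dimensional space: a smooth function satisfies
`f a - f b = G (a, b) (a - b)` with a smooth `G` that restricts to the derivative of `f` on the
diagonal. -/
theorem exists_contDiff_hadamard {f : V → ℝ} (hf : ContDiff ℝ ∞ f) :
    ∃ G : V × V → V →L[ℝ] ℝ, ContDiff ℝ ∞ G ∧ (∀ a b, f a - f b = G (a, b) (a - b)) ∧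
      ∀ a, G (a, a) = fderiv ℝ f a := by
  have hdf : ContDiff ℝ ∞ (fderiv ℝ f) := hf.fderiv_right (m := ∞) (by simp)
  have hcont : ∀ a b, Continuous fun s : ℝ => fderiv ℝ f (b + s • (a - b)) := fun a b =>
    hdf.continuous.comp (by fun_prop)
  refine ⟨fun q => ∫ s in (0 : ℝ)..1, fderiv ℝ f (q.2 + s • (q.1 - q.2)), ?_, ?_, ?_⟩
  · rw [contDiff_clm_apply_iff]
    intro v
    have h : ∀ q : V × V, (∫ s in (0 : ℝ)..1, fderiv ℝ f (q.2 + s • (q.1 - q.2))) v =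
        ∫ s in (0 : ℝ)..1, fderiv ℝ f (q.2 + s • (q.1 - q.2)) v := fun q =>
      ContinuousLinearMap.intervalIntegral_apply ((hcont _ _).intervalIntegrable _ _) v
    simp_rw [h]
    exact contDiff_integral_param
      (f := fun r : (V × V) × ℝ => fderiv ℝ f (r.1.2 + r.2 • (r.1.1 - r.1.2)) v)
      ((hdf.comp (by fun_prop)).clm_apply contDiff_const)
  · intro a b
    have hd : ∀ s ∈ uIcc (0 : ℝ) 1, HasDerivAt (fun s : ℝ => f (b + s • (a - b)))
        (fderiv ℝ f (b + s • (a - b)) (a - b)) s := by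
      intro s _
      have h1 : HasDerivAt (fun s : ℝ => b + s • (a - b)) (a - b) s := by
        simpa using ((hasDerivAt_id s).smul_const (a - b)).const_add b
      exact ((hf.differentiable (by simp)).differentiableAt.hasFDerivAt).comp_hasDerivAt s h1
    have := intervalIntegral.integral_eq_sub_of_hasDerivAt hd
      (((hcont a b).clm_apply continuous_const).intervalIntegrable _ _)
    rw [ContinuousLinearMap.intervalIntegral_apply ((hcont _ _).intervalIntegrable _ _), this]
    simp
  · intro a
    simp

end Hadamard

/-! ### Weil algebras are local, and smooth functions with values in them -/

section Weil

variable {W : Type*} [CommRing W] [Algebra ℝ W]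

/-- The quotient of a Weil algebra by its nilradical is `ℝ`, and the nilradical is nilpotent since
the algebra is noetherian. -/
theorem IsWeilAlgebra.exists_augmentation [IsWeilAlgebra W] :
    ∃ χ : W →ₐ[ℝ] ℝ, ∃ r : ℕ, RingHom.ker χ ^ r = ⊥ := by
  obtain ⟨hnt, hfin, V, hV, hnil⟩ := ‹IsWeilAlgebra W›
  have : IsNoetherianRing W := IsNoetherianRing.of_finite ℝ W
  let Q := W ⧸ nilradical W
  have hQ : Nontrivial Q := Ideal.Quotient.nontrivial_iff.2 fun h => by
    have h1 : (1 : W) ∈ nilradical W := h ▸ Submodule.mem_top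
    exact not_isNilpotent_one (mem_nilradical.1 h1)
  have hbij : Function.Bijective (Algebra.ofId ℝ Q) := by
    refine ⟨(algebraMap ℝ Q).injective, fun q => ?_⟩
    obtain ⟨w, rfl⟩ := Ideal.Quotient.mk_surjective q
    obtain ⟨a, ha, v, hv, rfl⟩ := Submodule.mem_sup.1
      (hV.sup_eq_top ▸ Submodule.mem_top : w ∈ (ℝ ∙ (1 : W)) ⊔ V)
    obtain ⟨c, rfl⟩ := Submodule.mem_span_singleton.1 ha
    refine ⟨c, ?_⟩
    have hv0 : Ideal.Quotient.mk (nilradical W) v = 0 :=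
      Ideal.Quotient.eq_zero_iff_mem.2 (hnil v hv)
    rw [map_add, hv0, add_zero, ← Algebra.algebraMap_eq_smul_one]
    rfl
  let e := AlgEquiv.ofBijective (Algebra.ofId ℝ Q) hbij
  refine ⟨(e.symm : Q →ₐ[ℝ] ℝ).comp (Ideal.Quotient.mkₐ ℝ (nilradical W)), ?_⟩
  obtain ⟨r, hr⟩ := IsNoetherianRing.isNilpotent_nilradical W
  refine ⟨r, ?_⟩
  have hker : RingHom.ker ((e.symm : Q →ₐ[ℝ] ℝ).comp (Ideal.Quotient.mkₐ ℝ (nilradical W))) =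
      nilradical W := by
    ext w
    rw [RingHom.mem_ker]
    exact (map_eq_zero_iff e.symm e.symm.injective).trans Ideal.Quotient.eq_zero_iff_mem
  rw [hker]
  exact hr

variable (W) in
/-- The augmentation `W → ℝ` of a Weil algebra, with the nilpotent elements as kernel. -/
noncomputable def weilAug [IsWeilAlgebra W] : W →ₐ[ℝ] ℝ :=
  (IsWeilAlgebra.exists_augmentation (W := W)).choose

variable (W) in
theorem exists_ker_weilAug_pow_eq_bot [IsWeilAlgebra W] :
    ∃ r : ℕ, RingHom.ker (weilAug W) ^ r = ⊥ :=
  (IsWeilAlgebra.exists_augmentation (W := W)).choose_spec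

theorem sub_algebraMap_weilAug_mem_ker [IsWeilAlgebra W] (w : W) :
    w - algebraMap ℝ W (weilAug W w) ∈ RingHom.ker (weilAug W) := by
  simp [RingHom.mem_ker]

theorem isNilpotent_of_mem_ker_weilAug [IsWeilAlgebra W] {w : W}
    (h : w ∈ RingHom.ker (weilAug W)) : IsNilpotent w := by
  obtain ⟨r, hr⟩ := exists_ker_weilAug_pow_eq_bot W
  exact ⟨r, by simpa [hr] using Ideal.pow_mem_pow h r⟩

theorem isUnit_of_weilAug_ne_zero [IsWeilAlgebra W] {w : W} (h : weilAug W w ≠ 0) :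
    IsUnit w := by
  have hn := isNilpotent_of_mem_ker_weilAug (sub_algebraMap_weilAug_mem_ker w)
  have hu : IsUnit (algebraMap ℝ W (weilAug W w)) := (isUnit_iff_ne_zero.2 h).map _
  simpa using hn.isUnit_add_left_of_commute hu (Commute.all _ _)

/-- An element of a Weil algebra that lies in every power of the nilpotent ideal is zero. -/
theorem eq_zero_of_forall_mem_ker_weilAug_pow [IsWeilAlgebra W] {w : W}
    (h : ∀ r : ℕ, w ∈ RingHom.ker (weilAug W) ^ r) : w = 0 := by
  obtain ⟨r, hr⟩ := exists_ker_weilAug_pow_eq_bot W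
  simpa [hr] using h r

variable {E H Y E' H' Z : Type*}
  [NormedAddCommGroup E] [NormedSpace ℝ E] [TopologicalSpace H] {I : ModelWithCorners ℝ E H}
  [TopologicalSpace Y] [ChartedSpace H Y]
  [NormedAddCommGroup E'] [NormedSpace ℝ E'] [TopologicalSpace H'] {I' : ModelWithCorners ℝ E' H'}
  [TopologicalSpace Z] [ChartedSpace H' Z]

variable (I) in
/-- Smoothness at a point of a function with values in a real vector space `W` that carries no
topology: composition with each linear functional is smooth. -/
def WeakSmoothAt (s : Y → W) (y : Y) : Prop :=
  ∀ l : W →ₗ[ℝ] ℝ, ContMDiffAt I 𝓘(ℝ, ℝ) ∞ (fun z => l (s z)) y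

variable {s s' : Y → W} {y : Y}

theorem WeakSmoothAt.add (h : WeakSmoothAt I s y) (h' : WeakSmoothAt I s' y) :
    WeakSmoothAt I (fun z => s z + s' z) y := fun l => by
  simp only [map_add]
  exact (h l).add (h' l)

theorem WeakSmoothAt.sub (h : WeakSmoothAt I s y) (h' : WeakSmoothAt I s' y) :
    WeakSmoothAt I (fun z => s z - s' z) y := fun l => by
  simp only [map_sub]
  exact (h l).sub (h' l)

theorem WeakSmoothAt.sum {ι : Type*} {t : Finset ι} {s : ι → Y → W}
    (h : ∀ i ∈ t, WeakSmoothAt I (s i) y) : WeakSmoothAt I (fun z => ∑ i ∈ t, s i z) y :=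
  fun l => by
    simp only [map_sum]
    exact ContMDiffAt.sum fun i hi => h i hi l

theorem weakSmoothAt_algebraMap {f : Y → ℝ} (h : ContMDiffAt I 𝓘(ℝ, ℝ) ∞ f y) :
    WeakSmoothAt I (fun z => algebraMap ℝ W (f z)) y := fun l => by
  simp only [Algebra.algebraMap_eq_smul_one, map_smul, smul_eq_mul]
  exact h.mul contMDiffAt_const

theorem WeakSmoothAt.mul [Module.Finite ℝ W] (h : WeakSmoothAt I s y)
    (h' : WeakSmoothAt I s' y) : WeakSmoothAt I (fun z => s z * s' z) y := fun l => by
  let b := Module.finBasis ℝ W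
  have e : ∀ z, l (s z * s' z) =
      ∑ i, ∑ j, b.coord i (s z) * b.coord j (s' z) * l (b i * b j) := by
    intro z
    conv_lhs => rw [← b.sum_repr (s z), ← b.sum_repr (s' z)]
    simp only [Finset.sum_mul_sum, map_sum, smul_mul_smul_comm, map_smul, smul_eq_mul,
      Module.Basis.coord_apply]
  simp only [e]
  exact ContMDiffAt.sum fun i _ => ContMDiffAt.sum fun j _ =>
    ((h _).mul (h' _)).mul contMDiffAt_const

theorem WeakSmoothAt.comp {g : Z → Y} {z : Z} (h : WeakSmoothAt I s (g z))
    (hg : ContMDiffAt I' I ∞ g z) : WeakSmoothAt I' (fun x => s (g x)) z :=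
  fun l => (h l).comp z hg

theorem WeakSmoothAt.congr_of_eventuallyEq (h : WeakSmoothAt I s y) (he : s' =ᶠ[𝓝 y] s) :
    WeakSmoothAt I s' y :=
  fun l => (h l).congr_of_eventuallyEq (he.fun_comp l)

end Weil

/-! ### Weil algebra valued points of a vector space -/

section LinearCase

variable {E : Type*} [NormedAddCommGroup E] [NormedSpace ℝ E]

/-- A smooth function on a vector space as an element of the algebra of smooth functions. -/
def ofContDiff (f : E → ℝ) (hf : ContDiff ℝ ∞ f) : SmoothFun 𝓘(ℝ, E) E := ⟨f, hf.contMDiff⟩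

/-- A linear functional as a smooth function. -/
def linFun (l : E →L[ℝ] ℝ) : SmoothFun 𝓘(ℝ, E) E := ofContDiff l l.contDiff

@[simp] theorem linFun_apply (l : E →L[ℝ] ℝ) (x : E) : linFun l x = l x := rfl

/-- The directional derivative of a smooth function along a constant vector field. -/
noncomputable def dirDeriv (v : E) : SmoothFun 𝓘(ℝ, E) E →ₗ[ℝ] SmoothFun 𝓘(ℝ, E) E where
  toFun f := ofContDiff (fun x => fderiv ℝ f x v)
    ((f.contMDiff.contDiff.fderiv_right (m := ∞) (by simp)).clm_apply contDiff_const)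
  map_add' f g := by
    ext x
    have hf := (f.contMDiff.contDiff.differentiable (by simp)).differentiableAt (x := x)
    have hg := (g.contMDiff.contDiff.differentiable (by simp)).differentiableAt (x := x)
    exact congrArg (fun L : E →L[ℝ] ℝ => L v) (fderiv_add hf hg)
  map_smul' c f := by
    ext x
    have hf := (f.contMDiff.contDiff.differentiable (by simp)).differentiableAt (x := x)
    exact congrArg (fun L : E →L[ℝ] ℝ => L v) (fderiv_const_smul hf c)

@[simp] theorem dirDeriv_apply (v : E) (f : SmoothFun 𝓘(ℝ, E) E) (x : E) :
    dirDeriv v f x = fderiv ℝ f x v := rfl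

theorem dirDeriv_mul (v : E) (f g : SmoothFun 𝓘(ℝ, E) E) :
    dirDeriv v (f * g) = f * dirDeriv v g + dirDeriv v f * g := by
  ext x
  have hf := (f.contMDiff.contDiff.differentiable (by simp)).differentiableAt (x := x)
  have hg := (g.contMDiff.contDiff.differentiable (by simp)).differentiableAt (x := x)
  refine (congrArg (fun L : E →L[ℝ] ℝ => L v) (fderiv_mul hf hg)).trans ?_
  simp [mul_comm]

theorem dirDeriv_linFun (v : E) (l : E →L[ℝ] ℝ) :
    dirDeriv v (linFun l) = algebraMap ℝ _ (l v) := by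
  ext x
  refine (congrArg (fun L : E →L[ℝ] ℝ => L v) (l.fderiv (x := x))).trans rfl

variable {W : Type*} [CommRing W] [Algebra ℝ W] [IsWeilAlgebra W]

theorem linFun_sub_mem_ker {α : SmoothFun 𝓘(ℝ, E) E →ₐ[ℝ] W} {x : E}
    (hx : ∀ f, weilAug W (α f) = f x) (l : E →L[ℝ] ℝ) :
    α (linFun l) - algebraMap ℝ W (l x) ∈ RingHom.ker (weilAug W) := by
  simp [RingHom.mem_ker, hx]

variable [FiniteDimensional ℝ E]

variable (E) in
/-- The coordinate functionals of a finite-dimensional space in a fixed basis. -/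
noncomputable def basisCoord (j : Fin (Module.finrank ℝ E)) : E →L[ℝ] ℝ :=
  LinearMap.toContinuousLinearMap ((Module.finBasis ℝ E).coord j)

theorem sum_basisCoord_smul (x : E) : ∑ j, basisCoord E j x • Module.finBasis ℝ E j = x := by
  simp [basisCoord]

variable {T : Type*} [NormedAddCommGroup T] [NormedSpace ℝ T] [FiniteDimensional ℝ T]

/-- Hadamard's lemma with parameters, in coordinates. -/
theorem exists_contDiff_hadamard_coord {f : E × T → ℝ} (hf : ContDiff ℝ ∞ f) :
    ∃ G : Fin (Module.finrank ℝ E) → E × (E × T) → ℝ, (∀ j, ContDiff ℝ ∞ (G j)) ∧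
      ∀ x x' t, f (x, t) = f (x', t) +
        ∑ j, (basisCoord E j x - basisCoord E j x') * G j (x, (x', t)) := by
  obtain ⟨G, hG, h, -⟩ := exists_contDiff_hadamard hf
  refine ⟨fun j q => G ((q.1, q.2.2), (q.2.1, q.2.2)) (Module.finBasis ℝ E j, 0),
    fun j => (hG.comp (by fun_prop)).clm_apply contDiff_const, fun x x' t => ?_⟩
  rw [← sub_eq_iff_eq_add', h (x, t) (x', t)]
  have e : ((x, t) - (x', t) : E × T) =
      ∑ j, (basisCoord E j x - basisCoord E j x') • ((Module.finBasis ℝ E j, 0) : E × T) := by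
    conv_lhs => rw [Prod.mk_sub_mk, sub_self, ← sum_basisCoord_smul (x - x')]
    refine Prod.ext ?_ ?_ <;> simp [Prod.fst_sum, Prod.snd_sum]
  conv_lhs => rw [e]
  simp only [map_sum, map_smul, smul_eq_mul]

theorem exists_hadamard_at (f : SmoothFun 𝓘(ℝ, E) E) (x' : E) :
    ∃ G : Fin (Module.finrank ℝ E) → SmoothFun 𝓘(ℝ, E) E,
      f = algebraMap ℝ _ (f x') +
        ∑ j, (linFun (basisCoord E j) - algebraMap ℝ _ (basisCoord E j x')) * G j := by
  obtain ⟨G, hG, h⟩ := exists_contDiff_hadamard_coord (T := ℝ) (f := fun q : E × ℝ => f q.1)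
    (f.contMDiff.contDiff.comp contDiff_fst)
  refine ⟨fun j => ofContDiff (fun x => G j (x, (x', 0))) ((hG j).comp (by fun_prop)), ?_⟩
  ext x
  refine (h x x' 0).trans ?_
  rw [ContMDiffMap.coe_add, Pi.add_apply]
  congr 1
  have hs : ∀ (s : Finset (Fin (Module.finrank ℝ E)))
      (g : Fin (Module.finrank ℝ E) → SmoothFun 𝓘(ℝ, E) E), (∑ j ∈ s, g j) x = ∑ j ∈ s, g j x :=
    fun s g => map_sum (⟨⟨fun f => f x, rfl⟩, fun _ _ => rfl⟩ : SmoothFun 𝓘(ℝ, E) E →+ ℝ) g s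
  rw [hs]
  rfl

/-- Every character of the algebra of smooth functions on a vector space is evaluation at a
point. -/
theorem exists_eval_of_algHom_linear (χ : SmoothFun 𝓘(ℝ, E) E →ₐ[ℝ] ℝ) :
    ∃ x, ∀ f, χ f = f x := by
  refine ⟨∑ j, χ (linFun (basisCoord E j)) • Module.finBasis ℝ E j, fun f => ?_⟩
  set x := ∑ j, χ (linFun (basisCoord E j)) • Module.finBasis ℝ E j
  have hx : ∀ j, basisCoord E j x = χ (linFun (basisCoord E j)) := fun j => by
    simp [x, basisCoord, Finsupp.single_apply]
  obtain ⟨G, hG⟩ := exists_hadamard_at f x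
  conv_lhs => rw [hG]
  simp [hx]

/-- A Weil algebra valued point of a vector space is determined by its coordinates. By Hadamard's
lemma, two points with equal coordinates agree modulo each power of the nilpotent ideal. -/
theorem algHom_linear_ext {α β : SmoothFun 𝓘(ℝ, E) E →ₐ[ℝ] W}
    (h : ∀ l, α (linFun l) = β (linFun l)) : α = β := by
  obtain ⟨x, hx⟩ := exists_eval_of_algHom_linear ((weilAug W).comp α)
  have key : ∀ r : ℕ, ∀ f, α f - β f ∈ RingHom.ker (weilAug W) ^ r := by
    intro r
    induction r with
    | zero => simp
    | succ r ih =>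
      intro f
      obtain ⟨G, hG⟩ := exists_hadamard_at f x
      have e : α f - β f = ∑ j, (α (linFun (basisCoord E j)) -
          algebraMap ℝ W (basisCoord E j x)) * (α (G j) - β (G j)) := by
        conv_lhs => rw [hG]
        simp [mul_sub, ← h]
      rw [e, pow_succ']
      exact Ideal.sum_mem _ fun j _ => Ideal.mul_mem_mul (linFun_sub_mem_ker hx _) (ih _)
  ext f
  exact sub_eq_zero.1 (eq_zero_of_forall_mem_ker_weilAug_pow fun r => key r f)

/-- The chain rule for derivations along a Weil algebra valued point of a vector space. -/
theorem derivation_linear_chain_rule (α : SmoothFun 𝓘(ℝ, E) E →ₐ[ℝ] W)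
    (b : SmoothFun 𝓘(ℝ, E) E →ₗ[ℝ] W) (hb : ∀ f g, b (f * g) = α f * b g + b f * α g)
    (f : SmoothFun 𝓘(ℝ, E) E) :
    b f = ∑ j, α (dirDeriv (Module.finBasis ℝ E j) f) * b (linFun (basisCoord E j)) := by
  obtain ⟨x, hx⟩ := exists_eval_of_algHom_linear ((weilAug W).comp α)
  -- `d` is a derivation along `α` that vanishes on the coordinates
  let d : SmoothFun 𝓘(ℝ, E) E → W := fun f =>
    b f - ∑ j, α (dirDeriv (Module.finBasis ℝ E j) f) * b (linFun (basisCoord E j))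
  have hd : ∀ f g, d (f * g) = α f * d g + d f * α g := by
    intro f g
    simp only [d, hb, dirDeriv_mul, map_add, map_mul, add_mul, Finset.sum_add_distrib, mul_sub,
      sub_mul, Finset.mul_sum, Finset.sum_mul]
    have : ∀ j, α (dirDeriv (Module.finBasis ℝ E j) f) * b (linFun (basisCoord E j)) * α g =
      α (dirDeriv (Module.finBasis ℝ E j) f) * α g * b (linFun (basisCoord E j)) := fun j => by
      ring
    simp only [this, mul_assoc]
    ring
  have hadd : ∀ f g, d (f + g) = d f + d g := by
    intro f g
    simp only [d, map_add, add_mul, Finset.sum_add_distrib]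
    ring
  have h0 : d 0 = 0 := by simp [d]
  have hsum : ∀ (s : Finset (Fin (Module.finrank ℝ E)))
      (g : Fin (Module.finrank ℝ E) → SmoothFun 𝓘(ℝ, E) E), d (∑ j ∈ s, g j) = ∑ j ∈ s, d (g j) :=
    fun s g => map_sum (⟨⟨d, h0⟩, hadd⟩ : SmoothFun 𝓘(ℝ, E) E →+ W) g s
  have hsmul : ∀ (c : ℝ) f, d (c • f) = c • d f := by
    intro c f
    simp only [d, map_smul, smul_mul_assoc, smul_sub, Finset.smul_sum]
  have h1 : d 1 = 0 := by simpa using hd 1 1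
  have hc : ∀ c : ℝ, d (algebraMap ℝ _ c) = 0 := by
    intro c
    rw [Algebra.algebraMap_eq_smul_one, hsmul, h1, smul_zero]
  have hl : ∀ i, d (linFun (basisCoord E i)) = 0 := by
    intro i
    have : ∀ j, basisCoord E i (Module.finBasis ℝ E j) = if j = i then 1 else 0 := fun j => by
      simp [basisCoord, Finsupp.single_apply]
    simp [d, dirDeriv_linFun, this]
  have key : ∀ r : ℕ, ∀ f, d f ∈ RingHom.ker (weilAug W) ^ r := by
    intro r
    induction r with
    | zero => simp
    | succ r ih =>
      intro f
      obtain ⟨G, hG⟩ := exists_hadamard_at f x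
      have e : d f = ∑ j, (α (linFun (basisCoord E j)) -
          algebraMap ℝ W (basisCoord E j x)) * d (G j) := by
        conv_lhs => rw [hG, hadd, hc, zero_add, hsum]
        refine Finset.sum_congr rfl fun j _ => ?_
        have hz : d (linFun (basisCoord E j) - algebraMap ℝ _ (basisCoord E j x)) = 0 := by
          rw [sub_eq_add_neg, ← map_neg, hadd, hl, hc, add_zero]
        rw [hd, hz]
        simp
      rw [e, pow_succ']
      exact Ideal.sum_mem _ fun j _ => Ideal.mul_mem_mul (linFun_sub_mem_ker hx _) (ih _)
  exact sub_eq_zero.1 (eq_zero_of_forall_mem_ker_weilAug_pow fun r => key r f)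

end LinearCase

/-! ### Evaluation of Weil algebra valued functions at points -/

section PointEval

variable {E H Y : Type*}
  [NormedAddCommGroup E] [NormedSpace ℝ E] [TopologicalSpace H] {I : ModelWithCorners ℝ E H}
  [TopologicalSpace Y] [ChartedSpace H Y] {W : Type*} [CommRing W] [Algebra ℝ W]

/-- Evaluation of smooth functions at a point. -/
noncomputable def pointEval (y : Y) : SmoothFun I Y →ₐ[ℝ] ℝ where
  toFun f := f y
  map_one' := rfl
  map_mul' _ _ := rfl
  map_zero' := rfl
  map_add' _ _ := rfl
  commutes' _ := rfl

@[simp] theorem pointEval_apply (y : Y) (f : SmoothFun I Y) : pointEval y f = f y := rfl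

variable (I W) in
/-- Evaluation at a point of the `W`-valued smooth function that an element of `C^∞(Y) ⊗ W`
represents. -/
noncomputable def pointEvalW (y : Y) : SmoothFun I Y ⊗[ℝ] W →ₐ[ℝ] W :=
  Algebra.TensorProduct.lift ((Algebra.ofId ℝ W).comp (pointEval y)) (AlgHom.id ℝ W)
    fun _ _ => Commute.all _ _

@[simp] theorem pointEvalW_tmul (y : Y) (f : SmoothFun I Y) (w : W) :
    pointEvalW I W y (f ⊗ₜ w) = f y • w := by
  simp [pointEvalW, Algebra.ofId_apply, Algebra.smul_def]

theorem weakSmoothAt_pointEvalW (τ : SmoothFun I Y ⊗[ℝ] W) (y : Y) :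
    WeakSmoothAt I (fun z => pointEvalW I W z τ) y := by
  induction τ with
  | zero => exact fun l => by simpa using contMDiffAt_const
  | add a b ha hb => simpa only [map_add] using ha.add hb
  | tmul f w =>
    intro l
    simp only [pointEvalW_tmul, map_smul, smul_eq_mul]
    exact (f.contMDiff y).mul contMDiffAt_const

variable [Module.Finite ℝ W]

theorem exists_eq_sum_finBasis_tmul (τ : SmoothFun I Y ⊗[ℝ] W) :
    ∃ f : Fin (Module.finrank ℝ W) → SmoothFun I Y,
      τ = ∑ i, f i ⊗ₜ[ℝ] Module.finBasis ℝ W i := by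
  induction τ with
  | zero => exact ⟨0, by simp⟩
  | add a b ha hb =>
    obtain ⟨f, rfl⟩ := ha
    obtain ⟨g, rfl⟩ := hb
    exact ⟨f + g, by simp [TensorProduct.add_tmul, Finset.sum_add_distrib]⟩
  | tmul f w =>
    refine ⟨fun i => (Module.finBasis ℝ W).repr w i • f, ?_⟩
    conv_lhs => rw [← (Module.finBasis ℝ W).sum_repr w, TensorProduct.tmul_sum]
    exact Finset.sum_congr rfl fun i _ => (TensorProduct.smul_tmul _ _ _).symm

/-- An element of `C^∞(Y) ⊗ W` is determined by the `W`-valued function it represents. -/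
theorem pointEvalW_ext {τ τ' : SmoothFun I Y ⊗[ℝ] W}
    (h : ∀ y, pointEvalW I W y τ = pointEvalW I W y τ') : τ = τ' := by
  rw [← sub_eq_zero]
  replace h : ∀ y, pointEvalW I W y (τ - τ') = 0 := fun y => by rw [map_sub, h, sub_self]
  obtain ⟨f, hf⟩ := exists_eq_sum_finBasis_tmul (τ - τ')
  have h0 : ∀ i, f i = 0 := by
    intro i
    ext y
    have := h y
    rw [hf, map_sum] at this
    simp only [pointEvalW_tmul] at this
    exact Fintype.linearIndependent_iff.1 (Module.finBasis ℝ W).linearIndependent _ this i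
  simp [hf, h0]

/-- Every smooth `W`-valued function is represented by an element of `C^∞(Y) ⊗ W`. -/
theorem exists_pointEvalW_eq {s : Y → W} (hs : ∀ y, WeakSmoothAt I s y) :
    ∃ τ : SmoothFun I Y ⊗[ℝ] W, ∀ y, pointEvalW I W y τ = s y := by
  let f : Fin (Module.finrank ℝ W) → SmoothFun I Y := fun i =>
    ⟨fun y => (Module.finBasis ℝ W).coord i (s y), fun y => hs y _⟩
  refine ⟨∑ i, f i ⊗ₜ Module.finBasis ℝ W i, fun y => ?_⟩
  rw [map_sum]
  simp only [pointEvalW_tmul]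
  exact (Module.finBasis ℝ W).sum_repr (s y)

/-- A family of algebra homomorphisms to `W` that depends smoothly on `y : Y` is the family of
values of one algebra homomorphism to `C^∞(Y) ⊗ W`. -/
theorem exists_algHom_of_family {A : Type*} [CommRing A] [Algebra ℝ A] (a : Y → A →ₐ[ℝ] W)
    (ha : ∀ f y, WeakSmoothAt I (fun z => a z f) y) :
    ∃ φ : A →ₐ[ℝ] SmoothFun I Y ⊗[ℝ] W, ∀ y f, pointEvalW I W y (φ f) = a y f := by
  choose φ hφ using fun f => exists_pointEvalW_eq (ha f)
  refine ⟨{ toFun := φ, map_one' := ?_, map_mul' := fun f g => ?_, map_zero' := ?_,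
            map_add' := fun f g => ?_, commutes' := fun c => ?_ }, fun y f => hφ f y⟩ <;>
  · refine pointEvalW_ext fun y => ?_
    simp [hφ, -Algebra.TensorProduct.algebraMap_apply]

end PointEval

/-! ### Existence and smooth dependence of Weil algebra valued points -/

/-- The exponential of a nilpotent derivation is an algebra endomorphism. -/
theorem exists_algHom_exp {B : Type*} [CommRing B] [Algebra ℝ B] (D : B →ₗ[ℝ] B)
    (hD : ∀ x y, D (x * y) = x * D y + D x * y) (hn : IsNilpotent D) :
    ∃ Θ : B →ₐ[ℝ] B, ∀ x, D (D x) = 0 → Θ x = x + D x := by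
  let _ : Module ℚ B := Module.compHom B (algebraMap ℚ ℝ)
  have hx : ∀ x, D (D x) = 0 → IsNilpotent.exp D x = x + D x := by
    intro x hx
    obtain ⟨n, hn⟩ := hn
    have h2 : D ^ (n + 2) = 0 := by rw [pow_add, hn, zero_mul]
    rw [IsNilpotent.exp_eq_sum h2, Finset.sum_range_succ', Finset.sum_range_succ']
    have h0 : ∀ k, (D ^ (k + 1 + 1)) x = 0 := fun k => by
      rw [pow_succ, pow_succ, Module.End.mul_apply, Module.End.mul_apply, hx, map_zero]
    simp only [LinearMap.add_apply, LinearMap.sum_apply, LinearMap.smul_apply, h0, smul_zero,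
      Finset.sum_const_zero]
    simp [add_comm]
  have h1 : D 1 = 0 := by simpa using hD 1 1
  refine ⟨AlgHom.ofLinearMap (IsNilpotent.exp D) ?_
    (Module.End.exp_mul_of_derivation ℝ B D hD hn), hx⟩
  simp [hx 1 (by simp [h1]), h1]

section Existence

variable {E : Type*} [NormedAddCommGroup E] [NormedSpace ℝ E]
  {W : Type*} [CommRing W] [Algebra ℝ W]

/-- The endomorphism `f ↦ exp (ν ∂_v) f` of `C^∞(E) ⊗ W`, for a nilpotent `ν : W`: the
translation by the infinitesimal vector `ν v`. -/
theorem exists_infinitesimal_translation (v : E) {ν : W} (hν : IsNilpotent ν) :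
    ∃ Θ : SmoothFun 𝓘(ℝ, E) E ⊗[ℝ] W →ₐ[ℝ] SmoothFun 𝓘(ℝ, E) E ⊗[ℝ] W,
      (∀ w, Θ (1 ⊗ₜ w) = 1 ⊗ₜ w) ∧
      ∀ l : E →L[ℝ] ℝ, Θ (linFun l ⊗ₜ 1) = linFun l ⊗ₜ 1 + 1 ⊗ₜ (l v • ν) := by
  let D := TensorProduct.map (dirDeriv v) (LinearMap.mulLeft ℝ ν)
  have hD : ∀ x y, D (x * y) = x * D y + D x * y := by
    intro x y
    induction x with
    | zero => simp
    | add a b ha hb => simp only [add_mul, map_add, ha, hb]; ring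
    | tmul f w =>
      induction y with
      | zero => simp
      | add a b ha hb => simp only [mul_add, map_add, ha, hb]; ring
      | tmul g w' =>
        simp only [D, Algebra.TensorProduct.tmul_mul_tmul, TensorProduct.map_tmul, dirDeriv_mul,
          LinearMap.mulLeft_apply, TensorProduct.add_tmul]
        congr 2 <;> ring
  have hn : IsNilpotent D := by
    obtain ⟨n, hn⟩ := hν
    refine ⟨n, ?_⟩
    rw [TensorProduct.map_pow, LinearMap.pow_mulLeft, hn]
    simp
  obtain ⟨Θ, hΘ⟩ := exists_algHom_exp D hD hn
  have hone : dirDeriv v (1 : SmoothFun 𝓘(ℝ, E) E) = 0 := by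
    simpa using dirDeriv_mul v 1 1
  have h1 : ∀ w, D (1 ⊗ₜ w) = 0 := by
    intro w
    simp [D, hone]
  have hl : ∀ l : E →L[ℝ] ℝ, D (linFun l ⊗ₜ 1) = 1 ⊗ₜ (l v • ν) := by
    intro l
    simp [D, dirDeriv_linFun, Algebra.algebraMap_eq_smul_one, TensorProduct.smul_tmul]
  refine ⟨Θ, fun w => ?_, fun l => ?_⟩
  · rw [hΘ _ (by rw [h1, map_zero]), h1, add_zero]
  · rw [hΘ _ (by rw [hl, h1]), hl]

variable [FiniteDimensional ℝ E] [IsWeilAlgebra W]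

/-- A Weil algebra valued point of a vector space with prescribed coordinates: evaluation at the
real part of the coordinates after the translations by their nilpotent parts. -/
theorem exists_algHom_linear (c : (E →L[ℝ] ℝ) →ₗ[ℝ] W) :
    ∃ α : SmoothFun 𝓘(ℝ, E) E →ₐ[ℝ] W, ∀ l, α (linFun l) = c l := by
  let e := Module.finBasis ℝ E
  let ν : Fin (Module.finrank ℝ E) → W := fun j =>
    c (basisCoord E j) - algebraMap ℝ W (weilAug W (c (basisCoord E j)))
  let x : E := ∑ j, weilAug W (c (basisCoord E j)) • e j
  have key : ∀ s : Finset (Fin (Module.finrank ℝ E)),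
      ∃ Θ : SmoothFun 𝓘(ℝ, E) E ⊗[ℝ] W →ₐ[ℝ] SmoothFun 𝓘(ℝ, E) E ⊗[ℝ] W,
      (∀ w, Θ (1 ⊗ₜ w) = 1 ⊗ₜ w) ∧
      ∀ l : E →L[ℝ] ℝ, Θ (linFun l ⊗ₜ 1) = linFun l ⊗ₜ 1 + 1 ⊗ₜ (∑ j ∈ s, l (e j) • ν j) := by
    intro s
    induction s using Finset.induction_on with
    | empty => exact ⟨AlgHom.id ℝ _, by simp⟩
    | insert j s hj ih =>
      obtain ⟨Θ, h1, h2⟩ := ih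
      obtain ⟨Θ', h1', h2'⟩ := exists_infinitesimal_translation (e j)
        (isNilpotent_of_mem_ker_weilAug (sub_algebraMap_weilAug_mem_ker (c (basisCoord E j))))
      refine ⟨Θ.comp Θ', fun w => ?_, fun l => ?_⟩
      · rw [AlgHom.comp_apply, h1', h1]
      · rw [AlgHom.comp_apply, h2', map_add, h1, h2, Finset.sum_insert hj, add_assoc,
          ← TensorProduct.tmul_add, add_comm (l (e j) • _)]
  obtain ⟨Θ, h1, h2⟩ := key Finset.univ
  refine ⟨((pointEvalW 𝓘(ℝ, E) W x).comp Θ).comp Algebra.TensorProduct.includeLeft, fun l => ?_⟩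
  have hl : l = ∑ j, l (e j) • basisCoord E j := by
    ext y
    conv_lhs => rw [← sum_basisCoord_smul y]
    simp [e, mul_comm]
  have e1 : ((pointEvalW 𝓘(ℝ, E) W x).comp Θ).comp Algebra.TensorProduct.includeLeft (linFun l) =
      pointEvalW 𝓘(ℝ, E) W x (Θ (linFun l ⊗ₜ 1)) := rfl
  have e2 : l x = ∑ j, l (e j) * weilAug W (c (basisCoord E j)) := by
    simp [x, mul_comm]
  rw [e1, h2, map_add, pointEvalW_tmul, pointEvalW_tmul, linFun_apply, e2]
  conv_rhs => rw [hl]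
  simp only [map_sum, map_smul, ν, smul_sub, Finset.sum_sub_distrib, Finset.sum_smul, mul_smul,
    Algebra.algebraMap_eq_smul_one, ContMDiffMap.coe_one, Pi.one_apply, one_smul]
  abel

end Existence

section Family

universe u

variable {W : Type*} [CommRing W] [Algebra ℝ W] [IsWeilAlgebra W]
  {F H Y : Type*}
  [NormedAddCommGroup F] [NormedSpace ℝ F] [TopologicalSpace H] {I : ModelWithCorners ℝ F H}
  [TopologicalSpace Y] [ChartedSpace H Y]
  {E : Type u} [NormedAddCommGroup E] [NormedSpace ℝ E] [FiniteDimensional ℝ E]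

/-- Substitution of a smooth family of `W`-points of `E`, with smooth coordinates, into a smooth
function with parameters is smooth. Hadamard's lemma around the real point reduces this modulo
a power of the nilpotent ideal to the previous power, at the price of more parameters. -/
theorem weakSmoothAt_family_linear {α : Y → SmoothFun 𝓘(ℝ, E) E →ₐ[ℝ] W}
    (hα : ∀ l y, WeakSmoothAt I (fun z => α z (linFun l)) y)
    {T : Type u} [NormedAddCommGroup T] [NormedSpace ℝ T] [FiniteDimensional ℝ T]
    {f : E × T → ℝ} (hf : ContDiff ℝ ∞ f) (q : Y × T) :
    WeakSmoothAt (I.prod 𝓘(ℝ, T))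
      (fun q : Y × T => α q.1 (ofContDiff (fun x => f (x, q.2)) (hf.comp (by fun_prop)))) q := by
  have : Module.Finite ℝ W := IsWeilAlgebra.finite
  choose g hg using fun y => exists_eval_of_algHom_linear ((weilAug W).comp (α y))
  have hgl : ∀ l : E →L[ℝ] ℝ, ContMDiff I 𝓘(ℝ, ℝ) ∞ fun y => l (g y) := by
    intro l y
    refine ((hα l y) (weilAug W).toLinearMap).congr_of_eventuallyEq
      (Eventually.of_forall fun z => ?_)
    exact (hg z (linFun l)).symm
  have hgs : ContMDiff I 𝓘(ℝ, E) ∞ g := by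
    have : g = fun y => ∑ j, basisCoord E j (g y) • Module.finBasis ℝ E j :=
      funext fun y => (sum_basisCoord_smul _).symm
    rw [this]
    exact ContMDiff.sum fun j _ => (hgl _).smul contMDiff_const
  have key : ∀ r : ℕ, ∀ (T : Type u) [NormedAddCommGroup T] [NormedSpace ℝ T]
      [FiniteDimensional ℝ T] (f : E × T → ℝ) (hf : ContDiff ℝ ∞ f), ∃ s : Y × T → W,
      (∀ q, WeakSmoothAt (I.prod 𝓘(ℝ, T)) s q) ∧ ∀ q : Y × T,
        α q.1 (ofContDiff (fun x => f (x, q.2)) (hf.comp (by fun_prop))) - s q ∈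
          RingHom.ker (weilAug W) ^ r := by
    intro r
    induction r with
    | zero =>
      intro T _ _ _ f hf
      refine ⟨fun _ => 0, fun q l => by simpa using contMDiffAt_const, by simp⟩
    | succ r ih =>
      intro T _ _ _ f hf
      obtain ⟨G, hG, h⟩ := exists_contDiff_hadamard_coord hf
      choose s hs hs' using fun j => ih (E × T) (G j) (hG j)
      let ν : Fin (Module.finrank ℝ E) → Y → W := fun j y =>
        α y (linFun (basisCoord E j)) - algebraMap ℝ W (basisCoord E j (g y))
      have hgq : ContMDiff (I.prod 𝓘(ℝ, T)) 𝓘(ℝ, E) ∞ fun q : Y × T => g q.1 :=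
        hgs.comp contMDiff_fst
      have hgt : ContMDiff (I.prod 𝓘(ℝ, T)) 𝓘(ℝ, E × T) ∞ fun q : Y × T => (g q.1, q.2) := by
        rw [contMDiff_prod_module_iff]
        exact ⟨hgq, contMDiff_snd⟩
      refine ⟨fun q => algebraMap ℝ W (f (g q.1, q.2)) +
        ∑ j, ν j q.1 * s j (q.1, (g q.1, q.2)), fun q => ?_, fun q => ?_⟩
      · refine (weakSmoothAt_algebraMap ((hf.contMDiff.comp hgt) q)).add
          (WeakSmoothAt.sum fun j _ => WeakSmoothAt.mul ?_ ?_)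
        · refine WeakSmoothAt.sub ?_ ?_
          · exact WeakSmoothAt.comp (s := fun y => α y (linFun (basisCoord E j)))
              (hα _ _) (contMDiff_fst q)
          · exact weakSmoothAt_algebraMap (((hgl _).comp contMDiff_fst) q)
        · exact WeakSmoothAt.comp (s := s j) (hs j _)
            ((contMDiff_fst.prodMk hgt) q)
      · obtain ⟨y, t⟩ := q
        have e : ofContDiff (fun x => f (x, t)) (hf.comp (by fun_prop)) =
            algebraMap ℝ _ (f (g y, t)) + ∑ j, (linFun (basisCoord E j) -
              algebraMap ℝ _ (basisCoord E j (g y))) *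
              ofContDiff (fun x => G j (x, (g y, t))) ((hG j).comp (by fun_prop)) := by
          ext x
          refine (h x (g y) t).trans ?_
          rw [ContMDiffMap.coe_add, Pi.add_apply, ← pointEval_apply x (∑ j, _), map_sum]
          rfl
        have e' : α y (ofContDiff (fun x => f (x, t)) (hf.comp (by fun_prop))) -
            (algebraMap ℝ W (f (g y, t)) + ∑ j, ν j y * s j (y, (g y, t))) =
            ∑ j, ν j y * (α y (ofContDiff (fun x => G j (x, (g y, t)))
              ((hG j).comp (by fun_prop))) - s j (y, (g y, t))) := by
          rw [e]
          simp [ν, mul_sub]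
        simp only [e']
        rw [pow_succ']
        exact Ideal.sum_mem _ fun j _ => Ideal.mul_mem_mul
          (linFun_sub_mem_ker (hg y) _) (hs' j (y, (g y, t)))
  obtain ⟨r, hr⟩ := exists_ker_weilAug_pow_eq_bot W
  obtain ⟨s, hs, hs'⟩ := key r T f hf
  refine (hs q).congr_of_eventuallyEq (Eventually.of_forall fun q => ?_)
  have := hs' q
  rw [hr] at this
  exact sub_eq_zero.1 this

end Family

/-! ### Characters and localization for smooth functions on a manifold -/

section Characters

variable {E H X : Type*} [NormedAddCommGroup E] [NormedSpace ℝ E] [FiniteDimensional ℝ E]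
  [TopologicalSpace H] {I : ModelWithCorners ℝ E H}
  [TopologicalSpace X] [ChartedSpace H X] [IsManifold I ∞ X] [T2Space X]

theorem exists_bump_subset {x : X} {U : Set X} (hU : U ∈ 𝓝 x) :
    ∃ χ : SmoothFun I X, χ x = 1 ∧ ∀ y, y ∉ U → χ y = 0 := by
  obtain ⟨f, -, hf⟩ := (SmoothBumpFunction.nhds_basis_tsupport (I := I) x).mem_iff.1 hU
  refine ⟨⟨f, f.contMDiff⟩, f.eq_one, fun y hy => ?_⟩
  exact image_eq_zero_of_notMem_tsupport fun h => hy (hf h)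

/-- Milnor's exercise: every character of the algebra of smooth functions on a second countable
Hausdorff manifold is evaluation at a point. -/
theorem exists_eval_of_algHom [SigmaCompactSpace X] [LocallyCompactSpace X]
    (χ : SmoothFun I X →ₐ[ℝ] ℝ) :
    ∃ x, ∀ f, χ f = f x := by
  by_contra! hcon
  choose f hf using hcon
  let K := CompactExhaustion.choice X
  -- `h` has compact sublevel sets
  obtain ⟨h, hh⟩ : ∃ h : SmoothFun I X, ∀ x, h x ∈ Ici (K.find x : ℝ) := by
    refine exists_contMDiffMap_forall_mem_convex_of_local_const I (fun x => convex_Ici _)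
      fun x => ⟨((K.find x + 1 : ℕ) : ℝ), ?_⟩
    have hx : x ∈ interior (K (K.find x + 1)) := K.subset_interior_succ _ (K.mem_find x)
    filter_upwards [isOpen_interior.mem_nhds hx] with y hy
    exact (Nat.cast_le (α := ℝ)).2 (K.mem_iff_find_le.1 (interior_subset hy))
  have hcomp : IsCompact {x | h x ≤ χ h} := by
    refine (K.isCompact ⌈χ h⌉₊).of_isClosed_subset
      (isClosed_le h.contMDiff.continuous continuous_const) fun x hx => ?_
    have h1 : (K.find x : ℝ) ≤ ⌈χ h⌉₊ := ((hh x).trans hx).trans (Nat.le_ceil _)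
    exact K.mem_iff_find_le.2 (Nat.cast_le.1 h1)
  let k : X → SmoothFun I X := fun x => f x - algebraMap ℝ _ (χ (f x))
  have hk : ∀ x, χ (k x) = 0 := fun x => by simp [k]
  have hkx : ∀ x, k x x ≠ 0 := fun x h0 => hf x (sub_eq_zero.1 h0).symm
  obtain ⟨t, ht⟩ := hcomp.elim_finite_subcover (fun x => {y | k x y ≠ 0})
    (fun x => (isOpen_ne_fun (k x).contMDiff.continuous continuous_const))
    (fun x _ => mem_iUnion.2 ⟨x, hkx x⟩)
  let q : SmoothFun I X := (h - algebraMap ℝ _ (χ h)) ^ 2 + ∑ x ∈ t, k x ^ 2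
  have hq : χ q = 0 := by simp [q, hk]
  have hqe : ∀ y, q y = (h y - χ h) ^ 2 + ∑ x ∈ t, k x y ^ 2 := fun y => by
    change pointEval y q = _
    simp only [q, map_add, map_pow, map_sum]
    rfl
  have hpos : ∀ y, q y ≠ 0 := by
    intro y hy
    rw [hqe] at hy
    have hs : 0 ≤ ∑ x ∈ t, k x y ^ 2 := Finset.sum_nonneg fun _ _ => sq_nonneg _
    have h1 : (h y - χ h) ^ 2 = 0 := by nlinarith [sq_nonneg (h y - χ h)]
    have h2 : ∑ x ∈ t, k x y ^ 2 = 0 := by linarith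
    have hyS : y ∈ {x | h x ≤ χ h} := (sub_eq_zero.1 (pow_eq_zero_iff two_ne_zero |>.1 h1)).le
    obtain ⟨x, hx, hxy⟩ := mem_iUnion₂.1 (ht hyS)
    exact hxy (pow_eq_zero_iff two_ne_zero |>.1
      ((Finset.sum_eq_zero_iff_of_nonneg fun _ _ => sq_nonneg _).1 h2 x hx))
  let q' : SmoothFun I X := ⟨fun y => (q y)⁻¹, q.contMDiff.inv₀ hpos⟩
  have : q * q' = 1 := by
    ext y
    exact mul_inv_cancel₀ (hpos y)
  simpa [hq] using congrArg χ this

variable {W : Type*} [CommRing W] [Algebra ℝ W] [IsWeilAlgebra W]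

omit [FiniteDimensional ℝ E] [IsManifold I ∞ X] [T2Space X] in
theorem algHom_congr_of_ne_zero {a : SmoothFun I X →ₐ[ℝ] W} {χ f g : SmoothFun I X}
    (hχ : weilAug W (a χ) ≠ 0) (h : ∀ y, χ y ≠ 0 → f y = g y) : a f = a g := by
  refine (isUnit_of_weilAug_ne_zero hχ).mul_left_cancel ?_
  rw [← map_mul, ← map_mul]
  congr 1
  ext y
  change χ y * f y = χ y * g y
  by_cases hy : χ y = 0
  · rw [hy, zero_mul, zero_mul]
  · rw [h y hy]

/-- A Weil algebra valued point depends only on the germ of a function at the real point. -/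
theorem algHom_congr_of_eqOn {a : SmoothFun I X →ₐ[ℝ] W} {x : X}
    (hx : ∀ f, weilAug W (a f) = f x) {U : Set X} (hU : U ∈ 𝓝 x) {f g : SmoothFun I X}
    (h : ∀ y ∈ U, f y = g y) : a f = a g := by
  obtain ⟨χ, h1, h0⟩ := exists_bump_subset (I := I) hU
  exact algHom_congr_of_ne_zero (χ := χ) (by rw [hx, h1]; exact one_ne_zero)
    fun y hy => h y (by_contra fun hn => hy (h0 y hn))

/-- A derivation along a Weil algebra valued point depends only on the germ of a function at the
real point. -/
theorem derivation_congr_of_eqOn {a : SmoothFun I X →ₐ[ℝ] W} {b : SmoothFun I X →ₗ[ℝ] W}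
    (hb : ∀ f g, b (f * g) = a f * b g + b f * a g) {x : X}
    (hx : ∀ f, weilAug W (a f) = f x) {U : Set X} (hU : U ∈ 𝓝 x) {f g : SmoothFun I X}
    (h : ∀ y ∈ U, f y = g y) : b f = b g := by
  obtain ⟨χ, h1, h0⟩ := exists_bump_subset (I := I) hU
  have hu : IsUnit (a χ) := isUnit_of_weilAug_ne_zero (by rw [hx, h1]; exact one_ne_zero)
  have e : χ * (f - g) = 0 := by
    ext y
    change χ y * (f y - g y) = 0
    by_cases hy : y ∈ U
    · rw [h y hy, sub_self, mul_zero]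
    · rw [h0 y hy, zero_mul]
  have h2 := hb χ (f - g)
  rw [e, map_zero, map_sub a, algHom_congr_of_eqOn hx hU h, sub_self, mul_zero, add_zero] at h2
  exact sub_eq_zero.1 (by rw [← map_sub]; exact hu.mul_right_eq_zero.1 h2.symm)

end Characters

/-! ### Local coordinates on a manifold and its tangent bundle -/

section Coordinates

variable {p : ℕ} {X : Type*} [TopologicalSpace X] [ChartedSpace (EuclideanSpace ℝ (Fin p)) X]
  [IsManifold (𝓡 p) ∞ X]

/-- The derivative `TX → E` of a smooth map `X → E` to a vector space. -/
noncomputable def dVec (u : C^∞⟮𝓡 p, X; 𝓘(ℝ, EuclideanSpace ℝ (Fin p)), EuclideanSpace ℝ (Fin p)⟯)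
    (v : TangentBundle (𝓡 p) X) : EuclideanSpace ℝ (Fin p) :=
  mfderiv (𝓡 p) 𝓘(ℝ, EuclideanSpace ℝ (Fin p)) u v.1 v.2

/-- The map `(u, du) : TX → E × E` induced by a smooth map `u : X → E`. -/
noncomputable def tangentVec
    (u : C^∞⟮𝓡 p, X; 𝓘(ℝ, EuclideanSpace ℝ (Fin p)), EuclideanSpace ℝ (Fin p)⟯) :
    C^∞⟮(𝓡 p).tangent, TangentBundle (𝓡 p) X;
      𝓘(ℝ, EuclideanSpace ℝ (Fin p) × EuclideanSpace ℝ (Fin p)),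
      EuclideanSpace ℝ (Fin p) × EuclideanSpace ℝ (Fin p)⟯ :=
  ⟨fun v => (u v.1, dVec u v), by
    rw [contMDiff_prod_module_iff]
    exact ⟨u.contMDiff.comp (Bundle.contMDiff_proj _),
      (contMDiff_snd_tangentBundle_modelSpace _ 𝓘(ℝ, EuclideanSpace ℝ (Fin p))).comp
      (u.contMDiff.contMDiff_tangentMap (m := ∞) (by simp))⟩⟩

variable (p X) in
/-- Local coordinates on a manifold that are restrictions of a global smooth map `u`, such that
all smooth functions on `X`, and all smooth functions on `TX × ℝ`, are over the open set `U`
smooth functions of `u`, respectively of `(u, du)` and the parameter. -/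
structure LocalCoord where
  /-- The domain of the coordinates. -/
  U : Set X
  /-- The coordinates, extended to a global map. -/
  u : C^∞⟮𝓡 p, X; 𝓘(ℝ, EuclideanSpace ℝ (Fin p)), EuclideanSpace ℝ (Fin p)⟯
  isOpen_U : IsOpen U
  isOpen_image : IsOpen (u '' U)
  surjective : ∀ x ∈ U, ∀ c, ∃ w : TangentSpace (𝓡 p) x, dVec u ⟨x, w⟩ = c
  factor : ∀ f : SmoothFun ((𝓡 p).tangent.prod 𝓘(ℝ, ℝ)) (TangentBundle (𝓡 p) X × ℝ),
    ∃ G : (EuclideanSpace ℝ (Fin p) × EuclideanSpace ℝ (Fin p)) × ℝ → ℝ, ContDiff ℝ ∞ G ∧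
      ∀ v, v.1 ∈ U → ∀ t, f (v, t) = G (tangentVec u v, t)

/-- Coordinates around a point: the chart, cut off by a bump function outside of a ball. -/
theorem exists_localCoord [T2Space X] (x₀ : X) : ∃ C : LocalCoord p X, x₀ ∈ C.U := by
  let E := EuclideanSpace ℝ (Fin p)
  let κ := extChartAt (𝓡 p) x₀
  let χ : SmoothBumpFunction (𝓡 p) x₀ := Classical.choice inferInstance
  let e := trivializationAt E (TangentSpace (𝓡 p)) x₀
  have hsrc : κ.source = (chartAt E x₀).source := extChartAt_source _ _
  have hbase : ∀ x ∈ κ.source, x ∈ e.baseSet := fun x hx => by rw [hsrc] at hx; exact hx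
  let u : C^∞⟮𝓡 p, X; 𝓘(ℝ, E), E⟯ := ⟨fun x => χ x • κ x, χ.contMDiff_smul contMDiffOn_extChartAt⟩
  -- over `U` the cut-off function is one
  let V : Set E := Metric.ball (κ x₀) χ.rIn
  let U : Set X := κ.source ∩ κ ⁻¹' V
  have hcl : Metric.closedBall (κ x₀) χ.rOut ⊆ κ.target := by
    have h := χ.closedBall_subset
    rwa [ModelWithCorners.range_eq_univ, inter_univ] at h
  have hV : V ⊆ κ.target :=
    ((Metric.ball_subset_ball χ.rIn_lt_rOut.le).trans Metric.ball_subset_closedBall).trans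
      hcl
  have hU : IsOpen U := by
    simpa only [U, hsrc] using isOpen_extChartAt_preimage (I := 𝓡 p) x₀ Metric.isOpen_ball
  have huU : ∀ x ∈ U, u x = κ x := by
    intro x hx
    have : χ x = 1 := χ.one_of_dist_le (hsrc ▸ hx.1) (Metric.mem_ball.1 hx.2).le
    change χ x • κ x = κ x
    rw [this, one_smul]
  have hd : ∀ v : TangentBundle (𝓡 p) X, v.1 ∈ U → dVec u v = (e v).2 := by
    intro v hv
    have hv' : v.1 ∈ (chartAt E x₀).source := hsrc ▸ hv.1
    have h1 : mfderiv (𝓡 p) 𝓘(ℝ, E) u v.1 = mfderiv (𝓡 p) 𝓘(ℝ, E) κ v.1 := by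
      refine Filter.EventuallyEq.mfderiv_eq ?_
      filter_upwards [hU.mem_nhds hv] with x hx using huU x hx
    have h2 := TangentBundle.continuousLinearMapAt_trivializationAt (I := 𝓡 p) (𝕜 := ℝ) hv'
    have h3 := e.continuousLinearMapAt_apply_of_mem (R := ℝ) (b := v.1) hv' v.2
    rw [h2] at h3
    rw [dVec, h1]
    exact h3
  refine ⟨⟨U, u, hU, ?_, ?_, ?_⟩, mem_extChartAt_source x₀, Metric.mem_ball_self χ.rIn_pos⟩
  · have : u '' U = V := by
      rw [image_congr huU]
      ext z
      constructor
      · rintro ⟨x, hx, rfl⟩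
        exact hx.2
      · intro hz
        exact ⟨κ.symm z, ⟨κ.map_target (hV hz), by rwa [mem_preimage, κ.right_inv (hV hz)]⟩,
          κ.right_inv (hV hz)⟩
    rw [this]
    exact Metric.isOpen_ball
  · intro x hx c
    have hx' : x ∈ e.baseSet := hbase x hx.1
    refine ⟨e.symmL ℝ x c, ?_⟩
    rw [hd _ hx, ← e.continuousLinearMapAt_apply_of_mem (R := ℝ) hx',
      e.continuousLinearMapAt_symmL hx']
  · intro f
    refine ⟨fun q => χ.toContDiffBump q.1.1 •
      f (e.toOpenPartialHomeomorph.symm (κ.symm q.1.1, q.1.2), q.2), ?_, ?_⟩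
    · rw [← contMDiff_iff_contDiff]
      intro q
      by_cases hq : q.1.1 ∈ κ.target
      · have h1 : ContMDiffAt 𝓘(ℝ, (E × E) × ℝ) 𝓘(ℝ, E) ∞
            (fun q : (E × E) × ℝ => q.1.1) q := contDiffAt_fst.fst.contMDiffAt
        have h2 : ContMDiffAt 𝓘(ℝ, (E × E) × ℝ) 𝓘(ℝ, E) ∞
            (fun q : (E × E) × ℝ => q.1.2) q := contDiffAt_fst.snd.contMDiffAt
        have h3 : ContMDiffAt 𝓘(ℝ, (E × E) × ℝ) (𝓡 p) ∞ (fun q : (E × E) × ℝ => κ.symm q.1.1) q :=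
          ((contMDiffOn_extChartAt_symm x₀).contMDiffAt
            ((isOpen_extChartAt_target x₀).mem_nhds hq)).comp q h1
        have h4 : (κ.symm q.1.1, q.1.2) ∈ e.target :=
          e.mem_target.2 (hbase _ (κ.map_target hq))
        have h5 : ContMDiffAt 𝓘(ℝ, (E × E) × ℝ) (𝓡 p).tangent ∞
            (fun q : (E × E) × ℝ => e.toOpenPartialHomeomorph.symm (κ.symm q.1.1, q.1.2)) q :=
          ((e.contMDiffOn_symm (n := ∞) (IB := 𝓡 p)).contMDiffAt
            (e.open_target.mem_nhds h4)).comp q (h3.prodMk h2)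
        have h6 : ContMDiffAt 𝓘(ℝ, (E × E) × ℝ) 𝓘(ℝ, ℝ) ∞
            (fun q : (E × E) × ℝ => q.2) q := contDiffAt_snd.contMDiffAt
        exact ((χ.toContDiffBump.contDiff.contMDiff _).comp q h1).smul
          ((f.contMDiff _).comp q (h5.prodMk h6))
      · refine (contMDiffAt_const (c := (0 : ℝ))).congr_of_eventuallyEq ?_
        have hopen : IsOpen {q : (E × E) × ℝ | q.1.1 ∉ Metric.closedBall (κ x₀) χ.rOut} :=
          (Metric.isClosed_closedBall.isOpen_compl).preimage (by fun_prop)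
        filter_upwards [hopen.mem_nhds fun h => hq (hcl h)] with q hq
        have : χ.toContDiffBump q.1.1 = 0 := by
          refine χ.toContDiffBump.zero_of_le_dist ?_
          exact (not_le.1 fun h => hq (Metric.mem_closedBall.2 h)).le
        rw [this, zero_smul]
    · intro v hv t
      have h1 : tangentVec u v = (κ v.1, (e v).2) := Prod.ext (huU _ hv) (hd v hv)
      have h2 : χ.toContDiffBump (κ v.1) = 1 :=
        χ.toContDiffBump.one_of_mem_closedBall (Metric.ball_subset_closedBall hv.2)
      have hv' : v ∈ e.source := e.mem_source.2 (hbase _ hv.1)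
      have h3 : (v.1, (e v).2) = e v := Prod.ext (e.coe_fst hv').symm rfl
      simp only [h1, h2, one_smul, κ.left_inv hv.1, h3]
      exact congrArg (fun v => f (v, t)) (e.toOpenPartialHomeomorph.left_inv hv').symm

end Coordinates

/-! ### Weil algebra valued points of the tangent bundle -/

section TangentPoints

variable {p : ℕ} {X : Type*} [TopologicalSpace X] [ChartedSpace (EuclideanSpace ℝ (Fin p)) X]
  [IsManifold (𝓡 p) ∞ X]

theorem LocalCoord.exists_factor_tangent (C : LocalCoord p X)
    (h : SmoothFun (𝓡 p).tangent (TangentBundle (𝓡 p) X)) :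
    ∃ G : SmoothFun 𝓘(ℝ, EuclideanSpace ℝ (Fin p) × EuclideanSpace ℝ (Fin p))
      (EuclideanSpace ℝ (Fin p) × EuclideanSpace ℝ (Fin p)),
      ∀ v, v.1 ∈ C.U → h v = G (tangentVec C.u v) := by
  obtain ⟨G, hG, hfG⟩ := C.factor ⟨fun q => h q.1, h.contMDiff.comp contMDiff_fst⟩
  exact ⟨ofContDiff (fun z => G (z, 0)) (hG.comp (by fun_prop)), fun v hv => hfG v hv 0⟩

theorem LocalCoord.exists_factor (C : LocalCoord p X) (f : SmoothFun (𝓡 p) X) :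
    ∃ G : SmoothFun 𝓘(ℝ, EuclideanSpace ℝ (Fin p)) (EuclideanSpace ℝ (Fin p)),
      ∀ x ∈ C.U, f x = pullback C.u G x := by
  obtain ⟨G, hG⟩ := C.exists_factor_tangent (pullback (tangentProj p X) f)
  refine ⟨ofContDiff (fun z => G (z, 0)) (G.contMDiff.contDiff.comp (by fun_prop)),
    fun x hx => (hG ⟨x, 0⟩ hx).trans ?_⟩
  have : tangentVec C.u (⟨x, 0⟩ : TangentBundle (𝓡 p) X) = (C.u x, 0) :=
    Prod.ext rfl (map_zero _)
  rw [this]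
  rfl

theorem dFun_pullback
    (u : C^∞⟮𝓡 p, X; 𝓘(ℝ, EuclideanSpace ℝ (Fin p)), EuclideanSpace ℝ (Fin p)⟯)
    (G : SmoothFun 𝓘(ℝ, EuclideanSpace ℝ (Fin p)) (EuclideanSpace ℝ (Fin p)))
    (v : TangentBundle (𝓡 p) X) :
    dFun (pullback u G) v = fderiv ℝ G (u v.1) (dVec u v) := by
  have hG : MDifferentiableAt 𝓘(ℝ, EuclideanSpace ℝ (Fin p)) 𝓘(ℝ, ℝ) G (u v.1) :=
    (G.contMDiff _).mdifferentiableAt (by simp)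
  have hu : MDifferentiableAt (𝓡 p) 𝓘(ℝ, EuclideanSpace ℝ (Fin p)) u v.1 :=
    (u.contMDiff _).mdifferentiableAt (by simp)
  have := mfderiv_comp v.1 hG hu
  rw [mfderiv_eq_fderiv] at this
  exact congrArg (fun L => L v.2) this

theorem dFun_congr {f g : SmoothFun (𝓡 p) X} {U : Set X} (hU : IsOpen U)
    (h : ∀ x ∈ U, f x = g x) (v : TangentBundle (𝓡 p) X) (hv : v.1 ∈ U) :
    dFun f v = dFun g v := by
  have : mfderiv (𝓡 p) 𝓘(ℝ, ℝ) f v.1 = mfderiv (𝓡 p) 𝓘(ℝ, ℝ) g v.1 := by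
    refine Filter.EventuallyEq.mfderiv_eq ?_
    filter_upwards [hU.mem_nhds hv] with x hx using h x hx
  exact congrArg (fun L => L v.2) this

theorem pullback_tangentVec_linFun
    (u : C^∞⟮𝓡 p, X; 𝓘(ℝ, EuclideanSpace ℝ (Fin p)), EuclideanSpace ℝ (Fin p)⟯)
    (l : EuclideanSpace ℝ (Fin p) × EuclideanSpace ℝ (Fin p) →L[ℝ] ℝ) :
    pullback (tangentVec u) (linFun l) =
      pullback (tangentProj p X) (pullback u (linFun (l.comp (.inl ℝ _ _)))) +
      dFun (pullback u (linFun (l.comp (.inr ℝ _ _)))) := by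
  ext v
  have h : dFun (pullback u (linFun (l.comp (.inr ℝ _ _)))) v = l (0, dVec u v) := by
    rw [dFun_pullback]
    exact congrArg (fun L : EuclideanSpace ℝ (Fin p) →L[ℝ] ℝ => L (dVec u v))
      ((l.comp (.inr ℝ _ _)).fderiv)
  change l (u v.1, dVec u v) = l (u v.1, 0) + dFun (pullback u (linFun (l.comp (.inr ℝ _ _)))) v
  rw [h, ← map_add]
  simp

variable [T2Space X] {W : Type*} [CommRing W] [Algebra ℝ W] [IsWeilAlgebra W]

/-- A Weil algebra valued tangent vector depends only on the restriction of a function to the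
tangent spaces near the real base point. -/
theorem algHom_tangent_congr {Z : SmoothFun (𝓡 p).tangent (TangentBundle (𝓡 p) X) →ₐ[ℝ] W} {x : X}
    (hx : ∀ f, weilAug W (Z (pullback (tangentProj p X) f)) = f x) {U : Set X} (hU : U ∈ 𝓝 x)
    {f g : SmoothFun (𝓡 p).tangent (TangentBundle (𝓡 p) X)}
    (h : ∀ v, v.1 ∈ U → f v = g v) : Z f = Z g := by
  obtain ⟨χ, h1, h0⟩ := exists_bump_subset (I := 𝓡 p) hU
  exact algHom_congr_of_ne_zero (χ := pullback (tangentProj p X) χ)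
    (by rw [hx, h1]; exact one_ne_zero)
    fun v hv => h v (by_contra fun hn => hv (h0 _ hn))

/-- Over a coordinate domain, a Weil algebra valued tangent vector is a point of `E × E`. -/
theorem LocalCoord.exists_algHom_tangent_eq (C : LocalCoord p X)
    (h : SmoothFun (𝓡 p).tangent (TangentBundle (𝓡 p) X)) :
    ∃ G : SmoothFun 𝓘(ℝ, EuclideanSpace ℝ (Fin p) × EuclideanSpace ℝ (Fin p))
      (EuclideanSpace ℝ (Fin p) × EuclideanSpace ℝ (Fin p)),
      ∀ (Z : SmoothFun (𝓡 p).tangent (TangentBundle (𝓡 p) X) →ₐ[ℝ] W) (x : X), x ∈ C.U →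
        (∀ f, weilAug W (Z (pullback (tangentProj p X) f)) = f x) →
        Z h = Z.comp (pullback (tangentVec C.u)) G := by
  obtain ⟨G, hG⟩ := C.exists_factor_tangent h
  exact ⟨G, fun Z x hx hZ => algHom_tangent_congr hZ (C.isOpen_U.mem_nhds hx) hG⟩

variable [SecondCountableTopology X]

theorem exists_tangent_basePoint
    (Z : SmoothFun (𝓡 p).tangent (TangentBundle (𝓡 p) X) →ₐ[ℝ] W) :
    ∃ x, ∀ f, weilAug W (Z (pullback (tangentProj p X) f)) = f x := by
  have : LocallyCompactSpace X := Manifold.locallyCompact_of_finiteDimensional (𝓡 p)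
  exact exists_eval_of_algHom (((weilAug W).comp Z).comp (pullback (tangentProj p X)))

/-- A Weil algebra valued tangent vector is determined by its values on the functions on the base
and on their differentials. -/
theorem algHom_tangent_ext {Z Z' : SmoothFun (𝓡 p).tangent (TangentBundle (𝓡 p) X) →ₐ[ℝ] W}
    (h0 : ∀ f, Z (pullback (tangentProj p X) f) = Z' (pullback (tangentProj p X) f))
    (h1 : ∀ f, Z (dFun f) = Z' (dFun f)) : Z = Z' := by
  obtain ⟨x, hx⟩ := exists_tangent_basePoint Z
  obtain ⟨C, hC⟩ := exists_localCoord (p := p) x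
  ext h
  obtain ⟨G, hG⟩ := C.exists_algHom_tangent_eq (W := W) h
  rw [hG Z x hC hx, hG Z' x hC fun f => by rw [← h0, hx]]
  congr 1
  refine algHom_linear_ext fun l => ?_
  simp only [AlgHom.comp_apply, pullback_tangentVec_linFun, map_add, h0, h1]

/-- A derivation `b` along a Weil algebra valued point `a` of `X` is a Weil algebra valued
tangent vector. In coordinates `u`, it is the point `(a u, b u)` of `E × E`. -/
theorem exists_algHom_tangent (a : SmoothFun (𝓡 p) X →ₐ[ℝ] W) (b : SmoothFun (𝓡 p) X →ₗ[ℝ] W)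
    (hb : ∀ f g, b (f * g) = a f * b g + b f * a g) :
    ∃ Z : SmoothFun (𝓡 p).tangent (TangentBundle (𝓡 p) X) →ₐ[ℝ] W,
      (∀ f, Z (pullback (tangentProj p X) f) = a f) ∧ ∀ f, Z (dFun f) = b f := by
  let E := EuclideanSpace ℝ (Fin p)
  have : LocallyCompactSpace X := Manifold.locallyCompact_of_finiteDimensional (𝓡 p)
  obtain ⟨x, hx⟩ := exists_eval_of_algHom ((weilAug W).comp a)
  obtain ⟨C, hC⟩ := exists_localCoord (p := p) x
  have hUx := C.isOpen_U.mem_nhds hC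
  let c : (E × E →L[ℝ] ℝ) →ₗ[ℝ] W :=
    { toFun := fun l => a (pullback C.u (linFun (l.comp (.inl ℝ _ _)))) +
        b (pullback C.u (linFun (l.comp (.inr ℝ _ _))))
      map_add' := fun l l' => by
        have h1 : ∀ k k' : E →L[ℝ] ℝ, linFun (k + k') = linFun k + linFun k' := fun _ _ => rfl
        simp only [ContinuousLinearMap.add_comp, h1, map_add]
        abel
      map_smul' := fun r l => by
        have h1 : ∀ k : E →L[ℝ] ℝ, linFun (r • k) = r • linFun k := fun _ => rfl
        simp only [ContinuousLinearMap.smul_comp, h1, map_smul, RingHom.id_apply, smul_add] }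
  have hcfst : ∀ l : E →L[ℝ] ℝ, c (l.comp (.fst ℝ E E)) = a (pullback C.u (linFun l)) := by
    intro l
    have e : linFun ((l.comp (.fst ℝ E E)).comp (.inr ℝ E E)) = 0 := by
      ext y
      exact map_zero l
    change a (pullback C.u (linFun l)) +
      b (pullback C.u (linFun ((l.comp (.fst ℝ E E)).comp (.inr ℝ E E)))) = _
    rw [e, map_zero, map_zero, add_zero]
  have hcsnd : ∀ l : E →L[ℝ] ℝ, c (l.comp (.snd ℝ E E)) = b (pullback C.u (linFun l)) := by
    intro l
    have e : linFun ((l.comp (.snd ℝ E E)).comp (.inl ℝ E E)) = 0 := by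
      ext y
      exact map_zero l
    change a (pullback C.u (linFun ((l.comp (.snd ℝ E E)).comp (.inl ℝ E E)))) +
      b (pullback C.u (linFun l)) = _
    rw [e, map_zero, map_zero, zero_add]
  obtain ⟨Ω, hΩ⟩ := exists_algHom_linear c
  obtain ⟨z, hz⟩ := exists_eval_of_algHom_linear ((weilAug W).comp Ω)
  -- the real point of `Ω` lies over `u x`
  have hz1 : z.1 = C.u x := by
    have h1 : ∀ l : E →L[ℝ] ℝ, l z.1 = l (C.u x) := by
      intro l
      have := hz (linFun (l.comp (.fst ℝ E E)))
      rw [AlgHom.comp_apply, hΩ, hcfst] at this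
      exact this.symm.trans (hx _)
    exact (sum_basisCoord_smul z.1).symm.trans
      ((Finset.sum_congr rfl fun j _ => by rw [h1]).trans (sum_basisCoord_smul (C.u x)))
  have hnhds : (C.u '' C.U) ×ˢ univ ∈ 𝓝 z :=
    (C.isOpen_image.prod isOpen_univ).mem_nhds ⟨hz1 ▸ mem_image_of_mem _ hC, mem_univ _⟩
  -- `Ω` does not depend on the choice of a factorization through the coordinates
  have key : ∀ G G' : SmoothFun 𝓘(ℝ, E × E) (E × E),
      (∀ v : TangentBundle (𝓡 p) X, v.1 ∈ C.U → G (tangentVec C.u v) = G' (tangentVec C.u v)) →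
      Ω G = Ω G' := by
    intro G G' h
    refine algHom_congr_of_eqOn hz hnhds ?_
    rintro ⟨y, w⟩ ⟨⟨x', hx', rfl⟩, -⟩
    obtain ⟨w', rfl⟩ := C.surjective x' hx' w
    exact h ⟨x', w'⟩ hx'
  choose G hG using C.exists_factor_tangent
  have hfst : ∀ F : SmoothFun 𝓘(ℝ, E) E,
      Ω (pullback (⟨Prod.fst, contDiff_fst.contMDiff⟩ : C^∞⟮𝓘(ℝ, E × E), E × E; 𝓘(ℝ, E), E⟯) F) =
        a (pullback C.u F) := by
    intro F
    have : Ω.comp (pullback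
        (⟨Prod.fst, contDiff_fst.contMDiff⟩ : C^∞⟮𝓘(ℝ, E × E), E × E; 𝓘(ℝ, E), E⟯)) =
        a.comp (pullback C.u) := by
      refine algHom_linear_ext fun l => ?_
      exact (hΩ (l.comp (.fst ℝ E E))).trans (hcfst l)
    exact congrArg (fun L : SmoothFun 𝓘(ℝ, E) E →ₐ[ℝ] W => L F) this
  have hsnd : ∀ l : E →L[ℝ] ℝ, Ω (linFun (l.comp (.snd ℝ E E))) =
      b (pullback C.u (linFun l)) := fun l => (hΩ _).trans (hcsnd l)
  refine ⟨{ toFun := fun h => Ω (G h), map_one' := ?_, map_mul' := fun f g => ?_, map_zero' := ?_,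
            map_add' := fun f g => ?_, commutes' := fun r => ?_ }, fun f => ?_, fun f => ?_⟩
  · rw [← map_one Ω]
    exact key _ _ fun v hv => (hG _ v hv).symm
  · rw [← map_mul]
    refine key _ _ fun v hv => (hG _ v hv).symm.trans ?_
    exact congrArg₂ (· * ·) (hG f v hv) (hG g v hv)
  · rw [← map_zero Ω]
    exact key _ _ fun v hv => (hG _ v hv).symm
  · rw [← map_add]
    refine key _ _ fun v hv => (hG _ v hv).symm.trans ?_
    exact congrArg₂ (· + ·) (hG f v hv) (hG g v hv)
  · rw [← AlgHom.commutes Ω]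
    exact key _ _ fun v hv => (hG _ v hv).symm
  · obtain ⟨F, hF⟩ := C.exists_factor f
    change Ω (G _) = _
    rw [algHom_congr_of_eqOn hx hUx hF, ← hfst]
    exact key _ _ fun v hv => (hG _ v hv).symm.trans (hF v.1 hv)
  · obtain ⟨F, hF⟩ := C.exists_factor f
    change Ω (G _) = _
    have hch := derivation_linear_chain_rule (a.comp (pullback C.u))
      (b ∘ₗ (pullback C.u).toLinearMap) (fun f g => by simp [hb]) F
    simp only [LinearMap.comp_apply, AlgHom.toLinearMap_apply, AlgHom.comp_apply] at hch
    rw [derivation_congr_of_eqOn hb hx hUx hF, hch]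
    simp only [← hfst, ← hsnd, ← map_mul, ← map_sum]
    refine key _ _ fun v hv => (hG _ v hv).symm.trans ?_
    rw [dFun_congr C.isOpen_U hF v hv, dFun_pullback, ← pointEval_apply (tangentVec C.u v), map_sum]
    conv_lhs => rw [← sum_basisCoord_smul (dVec C.u v)]
    rw [map_sum]
    refine Finset.sum_congr rfl fun j _ => ?_
    rw [map_smul, smul_eq_mul, mul_comm]
    rfl

variable {F' H Y : Type*}
  [NormedAddCommGroup F'] [NormedSpace ℝ F'] [TopologicalSpace H] {I : ModelWithCorners ℝ F' H}
  [TopologicalSpace Y] [ChartedSpace H Y]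

omit [SecondCountableTopology X] in
/-- The real points of a smooth family of Weil algebra valued points stay, locally, in a given
neighbourhood. -/
theorem eventually_mem_of_basePoint {A : Y → SmoothFun (𝓡 p) X →ₐ[ℝ] W}
    (hA : ∀ f y, WeakSmoothAt I (fun z => A z f) y) {y₀ : Y} {x₀ : X}
    (hx₀ : ∀ f, weilAug W (A y₀ f) = f x₀) {U : Set X} (hU : U ∈ 𝓝 x₀) :
    ∀ᶠ y in 𝓝 y₀, ∀ x, (∀ f, weilAug W (A y f) = f x) → x ∈ U := by
  obtain ⟨χ, h1, h0⟩ := exists_bump_subset (I := 𝓡 p) hU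
  have hc : ContinuousAt (fun y => weilAug W (A y χ)) y₀ :=
    ((hA χ y₀) (weilAug W).toLinearMap).continuousAt
  have hne : weilAug W (A y₀ χ) ≠ 0 := by rw [hx₀, h1]; exact one_ne_zero
  filter_upwards [hc.eventually_ne hne] with y hy x hx
  by_contra hn
  exact hy (by rw [hx, h0 x hn])

/-- Substitution of a smooth family of Weil algebra valued tangent vectors into a function with
a real parameter is smooth. -/
theorem weakSmoothAt_family_tangent
    {Z : Y → SmoothFun (𝓡 p).tangent (TangentBundle (𝓡 p) X) →ₐ[ℝ] W}
    (h0 : ∀ f y, WeakSmoothAt I (fun z => Z z (pullback (tangentProj p X) f)) y)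
    (h1 : ∀ f y, WeakSmoothAt I (fun z => Z z (dFun f)) y)
    (f : SmoothFun ((𝓡 p).tangent.prod 𝓘(ℝ, ℝ)) (TangentBundle (𝓡 p) X × ℝ)) (q : Y × ℝ) :
    WeakSmoothAt (I.prod 𝓘(ℝ, ℝ)) (fun q : Y × ℝ => Z q.1 ⟨fun v => f (v, q.2),
      f.contMDiff.comp (contMDiff_id.prodMk contMDiff_const)⟩) q := by
  choose g hg using fun y => exists_tangent_basePoint (Z y)
  obtain ⟨C, hC⟩ := exists_localCoord (p := p) (g q.1)
  obtain ⟨G, hG, hfG⟩ := C.factor f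
  have hlin : ∀ l y, WeakSmoothAt I
      (fun z => (Z z).comp (pullback (tangentVec C.u)) (linFun l)) y := by
    intro l y
    simp only [AlgHom.comp_apply, pullback_tangentVec_linFun, map_add]
    exact (h0 _ y).add (h1 _ y)
  refine (weakSmoothAt_family_linear hlin hG q).congr_of_eventuallyEq ?_
  have hev := eventually_mem_of_basePoint (A := fun y => (Z y).comp (pullback (tangentProj p X)))
    h0 (hg q.1) (C.isOpen_U.mem_nhds hC)
  filter_upwards [continuousAt_fst.eventually hev] with q' hq'
  exact algHom_tangent_congr (hg q'.1) (C.isOpen_U.mem_nhds (hq' _ (hg q'.1)))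
    fun v hv => hfG v hv q'.2

/-- Differentiation with respect to a parameter commutes with a Weil algebra valued tangent
vector. -/
theorem hasDerivAt_algHom_tangent (Z : SmoothFun (𝓡 p).tangent (TangentBundle (𝓡 p) X) →ₐ[ℝ] W)
    (f : SmoothFun ((𝓡 p).tangent.prod 𝓘(ℝ, ℝ)) (TangentBundle (𝓡 p) X × ℝ))
    (f' : SmoothFun (𝓡 p).tangent (TangentBundle (𝓡 p) X))
    (hf' : ∀ v, HasDerivAt (fun t => f (v, t)) (f' v) 0) (l : W →ₗ[ℝ] ℝ) :
    HasDerivAt (fun t => l (Z ⟨fun v => f (v, t),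
      f.contMDiff.comp (contMDiff_id.prodMk contMDiff_const)⟩)) (l (Z f')) 0 := by
  let E := EuclideanSpace ℝ (Fin p)
  obtain ⟨x, hx⟩ := exists_tangent_basePoint Z
  obtain ⟨C, hC⟩ := exists_localCoord (p := p) x
  have hUx := C.isOpen_U.mem_nhds hC
  obtain ⟨G, hG, hfG⟩ := C.factor f
  obtain ⟨D, hD, hGD, hDd⟩ := exists_contDiff_hadamard hG
  -- `G (z, t) = G (z, 0) + t R (z, t)` with `R` smooth and `R (z, 0) = ∂_t G (z, 0)`
  let R : (E × E) × ℝ → ℝ := fun q => D (q, (q.1, 0)) (0, 1)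
  have hR : ContDiff ℝ ∞ R := (hD.comp (by fun_prop)).clm_apply contDiff_const
  have hGR : ∀ z t, G (z, t) = G (z, 0) + t * R (z, t) := by
    intro z t
    have e : ((z, t) - (z, 0) : (E × E) × ℝ) = t • (0, 1) := by simp
    rw [← sub_eq_iff_eq_add', hGD, e, map_smul, smul_eq_mul]
  let ζ := Z.comp (pullback (tangentVec C.u))
  let r : ℝ → W := fun t => ζ (ofContDiff (fun z => R (z, t)) (hR.comp (by fun_prop)))
  have hcont : ContinuousAt (fun t => l (r t)) 0 := by
    have := weakSmoothAt_family_linear (I := 𝓘(ℝ, ℝ)) (α := fun _ : ℝ => ζ)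
      (fun k y l => contMDiffAt_const) hR (0, 0) l
    exact this.continuousAt.comp (f := fun t : ℝ => ((0 : ℝ), t)) (by fun_prop)
  have he : ∀ t, Z ⟨fun v => f (v, t), f.contMDiff.comp (contMDiff_id.prodMk contMDiff_const)⟩ =
      ζ (ofContDiff (fun z => G (z, 0)) (hG.comp (by fun_prop))) + t • r t := by
    intro t
    rw [← map_smul, ← map_add]
    refine algHom_tangent_congr hx hUx fun v hv => ?_
    exact (hfG v hv t).trans (hGR _ _)
  have hr0 : Z f' = r 0 := by
    refine algHom_tangent_congr hx hUx fun v hv => ?_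
    refine (hf' v).unique ?_
    have h1 : HasDerivAt (fun t : ℝ => G (tangentVec C.u v, t))
        (fderiv ℝ G (tangentVec C.u v, 0) (0, 1)) 0 := by
      have h2 : HasDerivAt (fun t : ℝ => (tangentVec C.u v, t)) (0, 1) 0 :=
        (hasDerivAt_const _ _).prodMk (hasDerivAt_id _)
      exact ((hG.differentiable (by simp)).differentiableAt.hasFDerivAt).comp_hasDerivAt 0 h2
    rw [← hDd] at h1
    exact h1.congr_of_eventuallyEq (Eventually.of_forall fun t => hfG v hv t)
  rw [hr0, hasDerivAt_iff_tendsto_slope]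
  refine (hcont.tendsto.mono_left nhdsWithin_le_nhds).congr' ?_
  filter_upwards [self_mem_nhdsWithin] with t ht
  have ht' : t ≠ 0 := ht
  simp only [slope_def_field, he, map_add, map_smul, smul_eq_mul, zero_mul, sub_zero, add_zero]
  field_simp
  ring

end TangentPoints

/-! ### Vertical displacements in a local trivialization -/

section Displacement

theorem exists_contDiff_eventuallyEq {V : Type*} [NormedAddCommGroup V] [NormedSpace ℝ V]
    [FiniteDimensional ℝ V] {f : V → ℝ} {O : Set V} (hO : IsOpen O) {z : V} (hz : z ∈ O)
    (hf : ContDiffOn ℝ ∞ f O) : ∃ g : V → ℝ, ContDiff ℝ ∞ g ∧ g =ᶠ[𝓝 z] f := by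
  obtain ⟨r, hr, hrO⟩ := Metric.nhds_basis_closedBall.mem_iff.1 (hO.mem_nhds hz)
  let χ : ContDiffBump z := ⟨r / 2, r, half_pos hr, half_lt_self hr⟩
  refine ⟨fun x => χ x * f x, ?_, ?_⟩
  · rw [contDiff_iff_contDiffAt]
    intro x
    by_cases hx : x ∈ O
    · exact χ.contDiff.contDiffAt.mul (hf.contDiffAt (hO.mem_nhds hx))
    · refine (contDiffAt_const (c := (0 : ℝ))).congr_of_eventuallyEq ?_
      filter_upwards [Metric.isClosed_closedBall.isOpen_compl.mem_nhds fun h => hx (hrO h)]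
        with y hy
      have : χ y = 0 := χ.zero_of_le_dist (not_le.1 fun h => hy (Metric.mem_closedBall.2 h)).le
      rw [this, zero_mul]
  · filter_upwards [χ.eventuallyEq_one] with y hy
    rw [hy, Pi.one_apply, one_mul]

variable {m n p : ℕ}
  {M : Type*} [TopologicalSpace M] [T2Space M]
  [ChartedSpace (EuclideanSpace ℝ (Fin m)) M] [IsManifold (𝓡 m) ∞ M]
  {F : Type*} [TopologicalSpace F]
  [ChartedSpace (EuclideanSpace ℝ (Fin p)) F] [IsManifold (𝓡 p) ∞ F]

/-- A vertical displacement on `F` over `M`: a global smooth action `T` of small vectors of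
a Cartesian space by fibre preserving maps, together with fibre coordinates `y` in which it is
a translation near the points of a set `K`; near those points, smooth functions on `F` are smooth
functions of `y` and of a smooth map on `M`. -/
structure VerticalDisplacement (n : ℕ) (π : C^∞⟮𝓡 p, F; 𝓡 m, M⟯) (K : Set F) where
  /-- The displacement. -/
  T : C^∞⟮(𝓡 p).prod (𝓡 n), F × EuclideanSpace ℝ (Fin n); 𝓡 p, F⟯
  /-- The fibre coordinates. -/
  y : C^∞⟮𝓡 p, F; 𝓡 n, EuclideanSpace ℝ (Fin n)⟯
  T_zero : ∀ x, T (x, 0) = x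
  proj_T : ∀ x w, π (T (x, w)) = π x
  y_T : ∀ x ∈ K, ∀ᶠ x' in 𝓝 x, ∀ᶠ w in 𝓝 0, y (T (x', w)) = y x' + w
  factor : ∀ x ∈ K, ∃ z : C^∞⟮𝓡 m, M; 𝓡 m, EuclideanSpace ℝ (Fin m)⟯,
    ∀ f : SmoothFun (𝓡 p) F, ∃ G : EuclideanSpace ℝ (Fin m) × EuclideanSpace ℝ (Fin n) → ℝ,
      ContDiff ℝ ∞ G ∧ ∀ᶠ x' in 𝓝 x, f x' = G (z (π x'), y x')

omit [IsManifold (𝓡 p) ∞ F] in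
/-- Around each point of a fibre bundle there are vertical displacements, one for each cut-off
function `θ` with values in `[0, 1]` and support in a small set `U`: translate by `θ` times a small
vector in the chart of the fibre. -/
theorem exists_verticalDisplacement
    {N : Type*} [TopologicalSpace N] [ChartedSpace (EuclideanSpace ℝ (Fin n)) N]
    [IsManifold (𝓡 n) ∞ N]
    {π : C^∞⟮𝓡 p, F; 𝓡 m, M⟯} (hπ : IsSmoothFiberBundle n N π) (x₀ : F) :
    ∃ U : Set F, IsOpen U ∧ x₀ ∈ U ∧ ∀ (θ : SmoothFun (𝓡 p) F) (K : Set F),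
      (∀ x, θ x ∈ Icc 0 1) → (∀ x, x ∉ U → ∀ᶠ x' in 𝓝 x, θ x' = 0) →
      (∀ x ∈ K, ∀ᶠ x' in 𝓝 x, θ x' = 1) → Nonempty (VerticalDisplacement n π K) := by
  obtain ⟨e, hxe, he, he'⟩ := hπ (π x₀)
  let E := EuclideanSpace ℝ (Fin n)
  let κ := extChartAt (𝓡 n) (e x₀).2
  let y : F → E := fun x => κ (e x).2
  have hx₀ : x₀ ∈ e.source := e.mem_source.2 hxe
  obtain ⟨r, hr, hrκ⟩ : ∃ r > 0, Metric.ball (y x₀) (r + r) ⊆ κ.target := by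
    obtain ⟨s, hs, hsκ⟩ := Metric.mem_nhds_iff.1
      ((isOpen_extChartAt_target (I := 𝓡 n) (e x₀).2).mem_nhds (mem_extChartAt_target _))
    exact ⟨s / 2, half_pos hs, by rwa [add_halves]⟩
  let O : Set F := e.source ∩ e ⁻¹' (univ ×ˢ κ.source)
  have hO : IsOpen O := he.continuousOn.isOpen_inter_preimage e.open_source
    (isOpen_univ.prod (isOpen_extChartAt_source (I := 𝓡 n) (e x₀).2))
  have hyO : ContMDiffOn (𝓡 p) (𝓡 n) ∞ y O := by
    refine (contMDiffOn_extChartAt (I := 𝓡 n) (n := ∞) (x := (e x₀).2)).comp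
      (contMDiff_snd.comp_contMDiffOn (he.mono inter_subset_left)) fun x hx => ?_
    have := hx.2.2
    rwa [extChartAt_source] at this
  let U : Set F := O ∩ y ⁻¹' Metric.ball (y x₀) r
  have hU : IsOpen U := hyO.continuousOn.isOpen_inter_preimage hO Metric.isOpen_ball
  refine ⟨U, hU, ⟨⟨hx₀, mem_univ _, mem_extChartAt_source _⟩, Metric.mem_ball_self hr⟩,
    fun θ K hθ hθ0 hθ1 => ?_⟩
  have hKU : K ⊆ U := fun x hx => by
    by_contra hn
    have h := (hθ0 x hn).self_of_nhds
    rw [(hθ1 x hx).self_of_nhds] at h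
    exact one_ne_zero h
  -- `c w` is `w` near zero, and always shorter than `r`
  let χ : ContDiffBump (0 : E) := ⟨r / 2, r, half_pos hr, half_lt_self hr⟩
  let c : E → E := fun w => χ w • w
  have hc : ContDiff ℝ ∞ c := χ.contDiff.smul contDiff_id
  have hcr : ∀ w, ‖c w‖ < r := by
    intro w
    by_cases hw : ‖w‖ < r
    · rw [norm_smul, Real.norm_of_nonneg χ.nonneg]
      exact (mul_le_of_le_one_left (norm_nonneg _) χ.le_one).trans_lt hw
    · have : χ w = 0 := χ.zero_of_le_dist (by simpa using not_lt.1 hw)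
      simpa [c, this] using hr
  have hc0 : ∀ᶠ w in 𝓝 (0 : E), c w = w := by
    filter_upwards [χ.eventuallyEq_one] with w hw
    simp [c, hw]
  -- the displacement in the trivialization
  let T' : F × E → F := fun q =>
    e.toOpenPartialHomeomorph.symm (π q.1, κ.symm (y q.1 + θ q.1 • c q.2))
  have htgt : ∀ x ∈ U, ∀ w, y x + θ x • c w ∈ κ.target := by
    intro x hx w
    refine hrκ ?_
    rw [Metric.mem_ball, dist_eq_norm]
    have h1 : ‖θ x • c w‖ < r := by
      rw [norm_smul, Real.norm_of_nonneg (hθ x).1]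
      exact (mul_le_of_le_one_left (norm_nonneg _) (hθ x).2).trans_lt (hcr w)
    have h2 : ‖y x - y x₀‖ < r := by simpa [dist_eq_norm] using hx.2
    calc ‖y x + θ x • c w - y x₀‖ = ‖(y x - y x₀) + θ x • c w‖ := by congr 1; abel
      _ ≤ _ := norm_add_le _ _
      _ < r + r := add_lt_add h2 h1
  have hetgt : ∀ x ∈ U, ∀ ν : N, (π x, ν) ∈ e.target := fun x hx ν =>
    e.mem_target.2 (e.mem_source.1 hx.1.1)
  have hmk : ∀ x ∈ U, (π x, (e x).2) = e x := fun x hx => Prod.ext (e.coe_fst hx.1.1).symm rfl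
  have hT'0 : ∀ x ∈ U, ∀ w, θ x • c w = 0 → T' (x, w) = x := by
    intro x hx w h
    simp only [T', h, add_zero]
    have h1 : κ.symm (y x) = (e x).2 := κ.left_inv hx.1.2.2
    rw [h1, hmk x hx]
    exact e.toOpenPartialHomeomorph.left_inv hx.1.1
  have hT'e : ∀ x ∈ U, ∀ w, e (T' (x, w)) = (π x, κ.symm (y x + θ x • c w)) := fun x hx w =>
    e.toOpenPartialHomeomorph.right_inv (hetgt x hx _)
  have hT's : ∀ x ∈ U, ∀ w, T' (x, w) ∈ e.source := fun x hx w =>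
    e.toOpenPartialHomeomorph.map_target (hetgt x hx _)
  have hT'U : ContMDiffOn ((𝓡 p).prod (𝓡 n)) (𝓡 p) ∞ T' (U ×ˢ univ) := by
    have h1 : ContMDiffOn ((𝓡 p).prod (𝓡 n)) (𝓡 n) ∞
        (fun q : F × E => y q.1 + θ q.1 • c q.2) (U ×ˢ univ) :=
      (hyO.comp contMDiffOn_fst fun q hq => hq.1.1).add
        ((θ.contMDiff.comp contMDiff_fst).contMDiffOn.smul
          (hc.contMDiff.comp contMDiff_snd).contMDiffOn)
    have h2 : ContMDiffOn ((𝓡 p).prod (𝓡 n)) (𝓡 n) ∞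
        (fun q : F × E => κ.symm (y q.1 + θ q.1 • c q.2)) (U ×ˢ univ) :=
      (contMDiffOn_extChartAt_symm (I := 𝓡 n) (n := ∞) (e x₀).2).comp h1
        fun q hq => htgt q.1 hq.1 q.2
    exact he'.comp ((π.contMDiff.comp contMDiff_fst).contMDiffOn.prodMk h2)
      fun q hq => hetgt q.1 hq.1 _
  classical
  let T : F × E → F := fun q => if q.1 ∈ U then T' q else q.1
  have hTU : ∀ x ∈ U, ∀ w, T (x, w) = T' (x, w) := fun x hx w => if_pos hx
  have hT : ContMDiff ((𝓡 p).prod (𝓡 n)) (𝓡 p) ∞ T := by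
    rintro ⟨x, w⟩
    by_cases hx : x ∈ U
    · have ho : U ×ˢ univ ∈ 𝓝 (x, w) := (hU.prod isOpen_univ).mem_nhds ⟨hx, mem_univ _⟩
      refine (hT'U.contMDiffAt ho).congr_of_eventuallyEq ?_
      filter_upwards [ho] with q hq using hTU q.1 hq.1 q.2
    · refine contMDiffAt_fst.congr_of_eventuallyEq ?_
      filter_upwards [continuousAt_fst.eventually (hθ0 x hx)] with q hq
      by_cases hq' : q.1 ∈ U
      · exact (hTU q.1 hq' q.2).trans (hT'0 q.1 hq' q.2 (by rw [hq, zero_smul]))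
      · exact if_neg hq'
  have hy : ContMDiff (𝓡 p) (𝓡 n) ∞ fun x => θ x • y x := by
    intro x
    by_cases hx : x ∈ U
    · exact (θ.contMDiff x).smul (hyO.contMDiffAt (hO.mem_nhds hx.1))
    · refine (contMDiffAt_const (c := (0 : E))).congr_of_eventuallyEq ?_
      filter_upwards [hθ0 x hx] with x' hx'
      rw [hx', zero_smul]
  refine ⟨⟨⟨T, hT⟩, ⟨fun x => θ x • y x, hy⟩, fun x => ?_, fun x w => ?_, fun x hx => ?_,
    fun x hx => ?_⟩⟩
  · change T (x, 0) = x
    by_cases hx : x ∈ U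
    · rw [hTU x hx]
      exact hT'0 x hx 0 (by simp [c])
    · exact if_neg hx
  · change π (T (x, w)) = π x
    by_cases hx : x ∈ U
    · rw [hTU x hx, ← e.coe_fst (hT's x hx w), hT'e x hx w]
    · exact congrArg π (if_neg hx)
  · change ∀ᶠ x' in 𝓝 x, ∀ᶠ w in 𝓝 0, θ (T (x', w)) • y (T (x', w)) = θ x' • y x' + w
    filter_upwards [(hθ1 x hx).eventually_nhds, hU.mem_nhds (hKU hx)] with x' h1 hx'
    have hTc : ContinuousAt (fun w => T (x', w)) 0 :=
      (hT.continuous.comp (by fun_prop)).continuousAt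
    have hT0 : T (x', 0) = x' := by
      rw [hTU x' hx']
      exact hT'0 x' hx' 0 (by simp [c])
    rw [ContinuousAt, hT0] at hTc
    filter_upwards [hTc.eventually h1, hc0] with w hw hcw
    rw [hw, h1.self_of_nhds, one_smul, one_smul]
    change κ (e (T (x', w))).2 = _
    rw [hTU x' hx', hT'e x' hx', κ.right_inv (htgt x' hx' w), h1.self_of_nhds, one_smul, hcw]
  · have hxU := hKU hx
    let ζ := extChartAt (𝓡 m) (π x)
    obtain χ₀ : SmoothBumpFunction (𝓡 m) (π x) := Classical.choice inferInstance
    refine ⟨⟨fun b => χ₀ b • ζ b, χ₀.contMDiff_smul contMDiffOn_extChartAt⟩, fun f => ?_⟩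
    let P : EuclideanSpace ℝ (Fin m) × E → F := fun q =>
      e.toOpenPartialHomeomorph.symm (ζ.symm q.1, κ.symm q.2)
    let Q : Set (EuclideanSpace ℝ (Fin m) × E) := (ζ.target ∩ ζ.symm ⁻¹' e.baseSet) ×ˢ κ.target
    have hQ : IsOpen Q := ((continuousOn_extChartAt_symm (I := 𝓡 m) (π x)).isOpen_inter_preimage
      (isOpen_extChartAt_target _) e.open_baseSet).prod (isOpen_extChartAt_target _)
    have hP : ContMDiffOn 𝓘(ℝ, EuclideanSpace ℝ (Fin m) × E) (𝓡 p) ∞ P Q := by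
      refine he'.comp (ContMDiffOn.prodMk ?_ ?_) fun q hq => e.mem_target.2 hq.1.2
      · exact (contMDiffOn_extChartAt_symm (I := 𝓡 m) (n := ∞) (π x)).comp
          contDiff_fst.contMDiff.contMDiffOn fun q hq => hq.1.1
      · exact (contMDiffOn_extChartAt_symm (I := 𝓡 n) (n := ∞) (e x₀).2).comp
          contDiff_snd.contMDiff.contMDiffOn fun q hq => hq.2
    have hxQ : (ζ (π x), y x) ∈ Q := by
      refine ⟨⟨mem_extChartAt_target _, ?_⟩, κ.map_source hxU.1.2.2⟩
      rw [mem_preimage, extChartAt_to_inv]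
      exact e.mem_source.1 hxU.1.1
    obtain ⟨G, hG, hGe⟩ := exists_contDiff_eventuallyEq hQ hxQ
      (contMDiffOn_iff_contDiffOn.1 (f.contMDiff.comp_contMDiffOn hP))
    refine ⟨G, hG, ?_⟩
    have hcont : ContinuousAt (fun x' => (ζ (π x'), y x')) x :=
      ((continuousAt_extChartAt (I := 𝓡 m) (π x)).comp
        (f := π) π.contMDiff.continuous.continuousAt).prodMk
        (hyO.continuousOn.continuousAt (hO.mem_nhds hxU.1))
    filter_upwards [hcont.eventually hGe, hθ1 x hx, hU.mem_nhds hxU,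
      π.contMDiff.continuous.continuousAt.eventually χ₀.eventuallyEq_one,
      π.contMDiff.continuous.continuousAt.eventually
        ((isOpen_extChartAt_source (I := 𝓡 m) (π x)).mem_nhds (mem_extChartAt_source _))]
      with x' h1 h2 h3 h4 h5
    change f x' = G (χ₀ (π x') • ζ (π x'), θ x' • y x')
    rw [h4, h2, Pi.one_apply, one_smul, one_smul, h1]
    change f x' = f (e.toOpenPartialHomeomorph.symm (ζ.symm (ζ (π x')), κ.symm (y x')))
    rw [ζ.left_inv h5, show κ.symm (y x') = (e x').2 from κ.left_inv h3.1.2.2, hmk x' h3]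
    exact congrArg f (e.toOpenPartialHomeomorph.left_inv h3.1.1).symm

end Displacement

section DisplacementDerivative

variable {m n p : ℕ}
  {M : Type*} [TopologicalSpace M]
  [ChartedSpace (EuclideanSpace ℝ (Fin m)) M]
  {F : Type*} [TopologicalSpace F]
  [ChartedSpace (EuclideanSpace ℝ (Fin p)) F] [IsManifold (𝓡 p) ∞ F]
  {π : C^∞⟮𝓡 p, F; 𝓡 m, M⟯} {K : Set F}

/-- The fibre coordinates as real functions. -/
noncomputable def VerticalDisplacement.coord (D : VerticalDisplacement n π K) (j : Fin n) :
    SmoothFun (𝓡 p) F :=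
  pullback D.y (linFun (EuclideanSpace.proj j))

omit [IsManifold (𝓡 p) ∞ F] in
theorem contMDiff_displacement_line (D : VerticalDisplacement n π K) (j : Fin n) :
    ContMDiff ((𝓡 p).prod 𝓘(ℝ, ℝ × ℝ)) (𝓡 p) ∞
      (fun q : F × (ℝ × ℝ) => D.T (q.1, q.2.2 • EuclideanSpace.single j (1 : ℝ))) :=
  D.T.contMDiff.comp (contMDiff_fst.prodMk
    ((contDiff_snd.smul contDiff_const : ContDiff ℝ ∞
      fun t : ℝ × ℝ => t.2 • EuclideanSpace.single j (1 : ℝ)).contMDiff.comp contMDiff_snd))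

/-- The derivative of a function on `F` under the displacement along a basis vector. -/
noncomputable def VerticalDisplacement.partialDeriv (D : VerticalDisplacement n π K) (j : Fin n)
    (f : SmoothFun (𝓡 p) F) : SmoothFun (𝓡 p) F :=
  ⟨fun x => tDeriv (⟨fun q => f (D.T (q.1, q.2.2 • EuclideanSpace.single j (1 : ℝ))),
      f.contMDiff.comp (contMDiff_displacement_line D j)⟩ : ParamFun p F (ℝ × ℝ)) (x, (0 : ℝ)),
    (ContMDiffMap.contMDiff _).comp (contMDiff_id.prodMk contMDiff_const)⟩

theorem VerticalDisplacement.partialDeriv_apply (D : VerticalDisplacement n π K) (j : Fin n)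
    (f : SmoothFun (𝓡 p) F) (x : F) : D.partialDeriv j f x =
      deriv (fun s : ℝ => f (D.T (x, s • EuclideanSpace.single j (1 : ℝ)))) 0 := rfl

theorem sum_smul_single {n : ℕ} (w : EuclideanSpace ℝ (Fin n)) :
    ∑ j, w j • EuclideanSpace.single j (1 : ℝ) = w := by
  have := (EuclideanSpace.basisFun (Fin n) ℝ).sum_repr w
  simpa using this

/-- The derivative of a function along a moving point that is displaced along `s w`. -/
theorem VerticalDisplacement.hasDerivAt_T (D : VerticalDisplacement n π K)
    {c : ℝ → F} (hc : ContMDiff 𝓘(ℝ, ℝ) (𝓡 p) ∞ c) (w : EuclideanSpace ℝ (Fin n))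
    (f : SmoothFun (𝓡 p) F) {A : ℝ} (hA : HasDerivAt (fun s => f (c s)) A 0) :
    HasDerivAt (fun s : ℝ => f (D.T (c s, s • w)))
      (A + ∑ j, w j * D.partialDeriv j f (c 0)) 0 := by
  have hw : ContDiff ℝ ∞ fun q : ℝ × EuclideanSpace ℝ (Fin n) => f (D.T (c q.1, q.2)) := by
    rw [← contMDiff_iff_contDiff]
    exact f.contMDiff.comp (D.T.contMDiff.comp
      ((hc.comp contDiff_fst.contMDiff).prodMk contDiff_snd.contMDiff))
  have hL := ((hw.differentiable (by simp)).differentiableAt (x := (0, 0))).hasFDerivAt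
  set L := fderiv ℝ (fun q : ℝ × EuclideanSpace ℝ (Fin n) => f (D.T (c q.1, q.2))) (0, 0)
  have hcurve : ∀ (a : ℝ) (b : EuclideanSpace ℝ (Fin n)),
      HasDerivAt (fun s : ℝ => f (D.T (c (s * a), s • b))) (L (a, b)) 0 := by
    intro a b
    have h1 : HasDerivAt (fun s : ℝ => (s * a, s • b)) (a, b) 0 := by
      simpa using ((hasDerivAt_id (0 : ℝ)).mul_const a).prodMk
        ((hasDerivAt_id (0 : ℝ)).smul_const b)
    have h2 : HasFDerivAt (fun q : ℝ × EuclideanSpace ℝ (Fin n) => f (D.T (c q.1, q.2))) L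
        ((fun s : ℝ => (s * a, s • b)) 0) := by simpa using hL
    exact h2.comp_hasDerivAt 0 h1
  have h1 : L (1, 0) = A := by
    refine (hcurve 1 0).unique (hA.congr_of_eventuallyEq (Eventually.of_forall fun s => ?_))
    simp [D.T_zero]
  have h2 : ∀ j, L (0, EuclideanSpace.single j (1 : ℝ)) = D.partialDeriv j f (c 0) := by
    intro j
    rw [D.partialDeriv_apply, ← (hcurve 0 (EuclideanSpace.single j (1 : ℝ))).deriv]
    simp
  have h3 : L (1, w) = A + ∑ j, w j * D.partialDeriv j f (c 0) := by
    have e : ((1, w) : ℝ × EuclideanSpace ℝ (Fin n)) =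
        (1, 0) + ∑ j, w j • ((0, EuclideanSpace.single j (1 : ℝ)) :
          ℝ × EuclideanSpace ℝ (Fin n)) := by
      conv_lhs => rw [← sum_smul_single w]
      refine Prod.ext ?_ ?_ <;> simp [Prod.fst_sum, Prod.snd_sum]
    rw [e, map_add, map_sum, h1]
    simp only [map_smul, smul_eq_mul, h2]
  rw [← h3]
  simpa using hcurve 1 w

variable [T2Space F] {W : Type*} [CommRing W] [Algebra ℝ W] [IsWeilAlgebra W]

/-- The chain rule for a vertical derivation along a Weil algebra valued point of `F` whose real
point is in the set where the displacement is a translation in fibre coordinates. -/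
theorem VerticalDisplacement.chain_rule (D : VerticalDisplacement n π K)
    (a : SmoothFun (𝓡 p) F →ₐ[ℝ] W) (b : SmoothFun (𝓡 p) F →ₗ[ℝ] W)
    (hb : ∀ f g, b (f * g) = a f * b g + b f * a g)
    (hbπ : ∀ h : SmoothFun (𝓡 m) M, b (pullback π h) = 0)
    {x : F} (hx : ∀ f, weilAug W (a f) = f x) (hxK : x ∈ K) (f : SmoothFun (𝓡 p) F) :
    ∑ j, a (D.partialDeriv j f) * b (D.coord j) = b f := by
  obtain ⟨z, hz⟩ := D.factor x hxK
  obtain ⟨G, hG, hfG⟩ := hz f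
  let u :
      C^∞⟮𝓡 p, F; 𝓘(ℝ, EuclideanSpace ℝ (Fin m) × EuclideanSpace ℝ (Fin n)),
      EuclideanSpace ℝ (Fin m) × EuclideanSpace ℝ (Fin n)⟯ := ⟨fun x => (z (π x), D.y x), by
    rw [contMDiff_prod_module_iff]
    exact ⟨z.contMDiff.comp π.contMDiff, D.y.contMDiff⟩⟩
  let e : Fin n → EuclideanSpace ℝ (Fin m) × EuclideanSpace ℝ (Fin n) := fun j =>
    (0, EuclideanSpace.single j (1 : ℝ))
  let Gs : SmoothFun 𝓘(ℝ, EuclideanSpace ℝ (Fin m) × EuclideanSpace ℝ (Fin n))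
      (EuclideanSpace ℝ (Fin m) × EuclideanSpace ℝ (Fin n)) := ofContDiff G hG
  have h1 : b f = b (pullback u Gs) := derivation_congr_of_eqOn hb hx hfG fun _ h => h
  have h2 : ∀ l : EuclideanSpace ℝ (Fin m) × EuclideanSpace ℝ (Fin n) →L[ℝ] ℝ,
      b (pullback u (linFun l)) = ∑ j, l (e j) • b (D.coord j) := by
    intro l
    have : pullback u (linFun l) =
        pullback π (pullback z (linFun (l.comp (.inl ℝ _ _)))) + ∑ j, l (e j) • D.coord j := by
      ext x
      rw [ContMDiffMap.coe_add, Pi.add_apply, ← pointEval_apply x (∑ j, _), map_sum]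
      change l (z (π x), D.y x) = l (z (π x), 0) + ∑ j, l (e j) * (D.y x) j
      have e1 : (z (π x), D.y x) = (z (π x), 0) + ∑ j, (D.y x) j • e j := by
        conv_lhs => rw [← sum_smul_single (D.y x)]
        refine Prod.ext ?_ ?_ <;> simp [e, Prod.fst_sum, Prod.snd_sum]
      rw [e1, map_add, map_sum]
      simp only [map_smul, smul_eq_mul, mul_comm]
    rw [this, map_add, hbπ, zero_add, map_sum]
    simp only [map_smul]
  have h3 : ∀ j, dirDeriv (e j) Gs =
      ∑ k, basisCoord _ k (e j) • dirDeriv (Module.finBasis ℝ _ k) Gs := by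
    intro j
    ext x
    rw [← pointEval_apply x (∑ k, _), map_sum, dirDeriv_apply]
    conv_lhs => rw [← sum_basisCoord_smul (e j)]
    rw [map_sum]
    simp only [map_smul]
    rfl
  have h4 : ∀ j, a (D.partialDeriv j f) = a (pullback u (dirDeriv (e j) Gs)) := by
    intro j
    refine algHom_congr_of_eqOn hx (hfG.eventually_nhds.and (D.y_T x hxK)) ?_
    rintro x' ⟨h5, h6⟩
    have hline : ContinuousAt (fun s : ℝ => s • EuclideanSpace.single j (1 : ℝ)) 0 := by fun_prop
    have hTc : ContinuousAt (fun s : ℝ => D.T (x', s • EuclideanSpace.single j (1 : ℝ))) 0 :=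
      (D.T.contMDiff.continuous.comp (by fun_prop)).continuousAt
    rw [ContinuousAt, zero_smul] at hline
    rw [ContinuousAt, zero_smul, D.T_zero] at hTc
    have h7 : HasDerivAt (fun s : ℝ => G (u x' + s • e j)) (fderiv ℝ G (u x') (e j)) 0 := by
      have h8 : HasDerivAt (fun s : ℝ => u x' + s • e j) (e j) 0 := by
        simpa only [id, one_smul] using ((hasDerivAt_id (0 : ℝ)).smul_const (e j)).const_add (u x')
      have h9 : HasFDerivAt G (fderiv ℝ G (u x')) (u x' + (0 : ℝ) • e j) := by
        rw [zero_smul, add_zero]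
        exact ((hG.differentiable (by simp)).differentiableAt).hasFDerivAt
      exact h9.comp_hasDerivAt 0 h8
    rw [D.partialDeriv_apply]
    refine (h7.congr_of_eventuallyEq ?_).deriv
    filter_upwards [hTc.eventually h5, hline.eventually h6] with s hs hs'
    rw [hs, hs', D.proj_T]
    congr 1
    refine Prod.ext ?_ ?_ <;> simp [u, e]
  have hch := derivation_linear_chain_rule (a.comp (pullback u))
    (b ∘ₗ (pullback u).toLinearMap) (fun f g => by simp [hb]) Gs
  simp only [LinearMap.comp_apply, AlgHom.toLinearMap_apply, AlgHom.comp_apply, h2,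
    Finset.mul_sum] at hch
  rw [h1, hch, Finset.sum_comm]
  refine Finset.sum_congr rfl fun j _ => ?_
  rw [h4, h3, map_sum, map_sum, Finset.sum_mul]
  refine Finset.sum_congr rfl fun k _ => ?_
  rw [map_smul, map_smul, smul_mul_assoc, mul_smul_comm]

end DisplacementDerivative

section Differential

variable {p : ℕ} {X : Type*} [TopologicalSpace X] [ChartedSpace (EuclideanSpace ℝ (Fin p)) X]
  [IsManifold (𝓡 p) ∞ X]

variable (p X) in
/-- The differential as a linear map `C^∞(X) → C^∞(TX)`. -/
noncomputable def dFunLinear :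
    SmoothFun (𝓡 p) X →ₗ[ℝ] SmoothFun (𝓡 p).tangent (TangentBundle (𝓡 p) X) where
  toFun := dFun
  map_add' f g := by
    ext v
    have hf := (f.contMDiff v.1).mdifferentiableAt (by simp)
    have hg := (g.contMDiff v.1).mdifferentiableAt (by simp)
    exact congrArg (fun L => L v.2) (mfderiv_add hf hg)
  map_smul' c f := by
    ext v
    have hf := (f.contMDiff v.1).mdifferentiableAt (by simp)
    exact congrArg (fun L => L v.2) (const_smul_mfderiv hf c)

theorem dFun_mul (f g : SmoothFun (𝓡 p) X) : dFun (f * g) =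
    pullback (tangentProj p X) f * dFun g + dFun f * pullback (tangentProj p X) g := by
  ext v
  have hf := ((f.contMDiff v.1).mdifferentiableAt (by simp)).hasMFDerivAt
  have hg := ((g.contMDiff v.1).mdifferentiableAt (by simp)).hasMFDerivAt
  refine (congrArg (fun L => L v.2) (hf.mul hg).mfderiv).trans ?_
  change f v.1 * dFun g v + g v.1 * dFun f v = f v.1 * dFun g v + dFun f v * g v.1
  ring

end Differential

/-! ### A global curve through each point in each vertical direction -/

section VerticalCurves

variable {m n p : ℕ}
  {M : Type*} [TopologicalSpace M]
  [ChartedSpace (EuclideanSpace ℝ (Fin m)) M]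
  {F : Type*} [TopologicalSpace F]
  [ChartedSpace (EuclideanSpace ℝ (Fin p)) F] [IsManifold (𝓡 p) ∞ F]
  {π : C^∞⟮𝓡 p, F; 𝓡 m, M⟯}

/-- The fibre coordinates of a tangent vector. -/
noncomputable def VerticalDisplacement.dCoord {K : Set F} (D : VerticalDisplacement n π K)
    (v : TangentBundle (𝓡 p) F) : EuclideanSpace ℝ (Fin n) :=
  ∑ j, dFun (D.coord j) v • EuclideanSpace.single j (1 : ℝ)

theorem VerticalDisplacement.contMDiff_dCoord {K : Set F} (D : VerticalDisplacement n π K) :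
    ContMDiff (𝓡 p).tangent (𝓡 n) ∞ D.dCoord :=
  ContMDiff.sum fun j _ => (dFun (D.coord j)).contMDiff.smul contMDiff_const

theorem VerticalDisplacement.dCoord_apply {K : Set F} (D : VerticalDisplacement n π K)
    (v : TangentBundle (𝓡 p) F) (j : Fin n) : D.dCoord v j = dFun (D.coord j) v := by
  simp [VerticalDisplacement.dCoord, Finset.sum_apply, Pi.single_apply]

variable (ρ : ℕ → SmoothFun (𝓡 p) F) {K : ℕ → Set F}
  (D : ∀ i, VerticalDisplacement n π (K i))

/-- Successive displacements of the base point of `v`, the `i`-th one by `t ρ_i v`. -/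
noncomputable def curveSeq : ℕ →
    C^∞⟮(𝓡 p).tangent.prod 𝓘(ℝ, ℝ), TangentBundle (𝓡 p) F × ℝ; 𝓡 p, F⟯
  | 0 => ⟨fun q => q.1.1, (Bundle.contMDiff_proj _).comp contMDiff_fst⟩
  | i + 1 => ⟨fun q => (D i).T (curveSeq i q, q.2 • (ρ i q.1.1 • (D i).dCoord q.1)),
      (D i).T.contMDiff.comp ((curveSeq i).contMDiff.prodMk (contMDiff_snd.smul
        (((ρ i).contMDiff.comp ((Bundle.contMDiff_proj _).comp contMDiff_fst)).smul
          ((D i).contMDiff_dCoord.comp contMDiff_fst))))⟩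

theorem curveSeq_succ (i : ℕ) (q : TangentBundle (𝓡 p) F × ℝ) : curveSeq ρ D (i + 1) q =
    (D i).T (curveSeq ρ D i q, q.2 • (ρ i q.1.1 • (D i).dCoord q.1)) := rfl

theorem curveSeq_at_zero (i : ℕ) (v : TangentBundle (𝓡 p) F) : curveSeq ρ D i (v, 0) = v.1 := by
  induction i with
  | zero => rfl
  | succ i ih => rw [curveSeq_succ, ih, zero_smul, (D i).T_zero]

theorem proj_curveSeq (i : ℕ) (q : TangentBundle (𝓡 p) F × ℝ) :
    π (curveSeq ρ D i q) = π q.1.1 := by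
  induction i with
  | zero => rfl
  | succ i ih => rw [curveSeq_succ, (D i).proj_T, ih]

theorem curveSeq_eq_of_le {k l : ℕ} (hkl : k ≤ l) {q : TangentBundle (𝓡 p) F × ℝ}
    (h : ∀ i, k ≤ i → ρ i q.1.1 = 0) : curveSeq ρ D l q = curveSeq ρ D k q := by
  induction l, hkl using Nat.le_induction with
  | base => rfl
  | succ l hl ih => rw [curveSeq_succ, h l hl, zero_smul, smul_zero, (D l).T_zero, ih]

/-- The initial derivative of a function along the curves `curveSeq`. -/
noncomputable def curveDeriv (k : ℕ) (f : SmoothFun (𝓡 p) F) :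
    SmoothFun (𝓡 p).tangent (TangentBundle (𝓡 p) F) :=
  ∑ i ∈ Finset.range k, ∑ j, pullback (tangentProj p F) (ρ i) *
    (dFun ((D i).coord j) * pullback (tangentProj p F) ((D i).partialDeriv j f))

theorem hasDerivAt_curveSeq (k : ℕ) (f : SmoothFun (𝓡 p) F) (v : TangentBundle (𝓡 p) F) :
    HasDerivAt (fun t => f (curveSeq ρ D k (v, t))) (curveDeriv ρ D k f v) 0 := by
  induction k with
  | zero =>
    have : curveDeriv ρ D 0 f v = 0 := by simp [curveDeriv]
    rw [this]
    exact hasDerivAt_const (0 : ℝ) (f v.1)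
  | succ k ih =>
    have h := (D k).hasDerivAt_T (c := fun t => curveSeq ρ D k (v, t))
      ((curveSeq ρ D k).contMDiff.comp (contMDiff_const.prodMk contMDiff_id))
      (ρ k v.1 • (D k).dCoord v) f ih
    have e : curveDeriv ρ D (k + 1) f v = curveDeriv ρ D k f v +
        ∑ j, (ρ k v.1 • (D k).dCoord v) j *
          (D k).partialDeriv j f (curveSeq ρ D k (v, 0)) := by
      rw [curveDeriv, Finset.sum_range_succ, ContMDiffMap.coe_add, Pi.add_apply, curveDeriv,
        ← pointEval_apply v (∑ j, _), map_sum, curveSeq_at_zero]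
      congr 1
      refine Finset.sum_congr rfl fun j _ => ?_
      rw [PiLp.smul_apply, (D k).dCoord_apply, smul_eq_mul, mul_assoc]
      rfl
    rw [e]
    exact h

variable [T2Space F] {W : Type*} [CommRing W] [Algebra ℝ W] [IsWeilAlgebra W]

/-- On a Weil algebra valued vertical tangent vector, the initial derivative along the curves
`curveSeq` is the tangent vector itself: each displacement contributes its part `ρ_i` of it. -/
theorem algHom_curveDeriv (Z : SmoothFun (𝓡 p).tangent (TangentBundle (𝓡 p) F) →ₐ[ℝ] W)
    (hZ : ∀ h : SmoothFun (𝓡 m) M, Z (dFun (pullback π h)) = 0) {x : F}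
    (hx : ∀ f, weilAug W (Z (pullback (tangentProj p F) f)) = f x) (hK : ∀ i, tsupport (ρ i) ⊆ K i)
    {k : ℕ} (hk : ∀ᶠ x' in 𝓝 x, ∑ i ∈ Finset.range k, ρ i x' = 1) (f : SmoothFun (𝓡 p) F) :
    Z (curveDeriv ρ D k f) = Z (dFun f) := by
  let a := Z.comp (pullback (tangentProj p F))
  let b := Z.toLinearMap ∘ₗ dFunLinear p F
  have hb : ∀ f g, b (f * g) = a f * b g + b f * a g := by
    intro f g
    change Z (dFun (f * g)) = _
    rw [dFun_mul, map_add, map_mul, map_mul]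
    rfl
  have h1 : ∀ i, a (ρ i) * ∑ j, a ((D i).partialDeriv j f) * b ((D i).coord j) =
      a (ρ i) * b f := by
    intro i
    by_cases hi : x ∈ tsupport (ρ i)
    · rw [(D i).chain_rule a b hb hZ hx (hK i hi)]
    · have : a (ρ i) = a 0 := algHom_congr_of_eqOn hx
        ((isClosed_tsupport _).isOpen_compl.mem_nhds hi)
        fun y hy => image_eq_zero_of_notMem_tsupport hy
      rw [this, map_zero, zero_mul, zero_mul]
  have h2 : Z (curveDeriv ρ D k f) = ∑ i ∈ Finset.range k,
      a (ρ i) * ∑ j, a ((D i).partialDeriv j f) * b ((D i).coord j) := by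
    rw [curveDeriv, map_sum]
    refine Finset.sum_congr rfl fun i _ => ?_
    rw [map_sum, Finset.mul_sum]
    refine Finset.sum_congr rfl fun j _ => ?_
    rw [map_mul, map_mul, mul_comm (Z (dFun _))]
    rfl
  have h3 : a (∑ i ∈ Finset.range k, ρ i) = a 1 := by
    refine algHom_congr_of_eqOn hx hk fun y hy => ?_
    rw [← pointEval_apply y (∑ i ∈ _, _), map_sum]
    exact hy
  rw [h2, Finset.sum_congr rfl fun i _ => h1 i, ← Finset.sum_mul, ← map_sum, h3, map_one, one_mul]
  rfl

end VerticalCurves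

section VerticalExp

variable {m n p : ℕ}
  {M : Type*} [TopologicalSpace M] [T2Space M]
  [ChartedSpace (EuclideanSpace ℝ (Fin m)) M] [IsManifold (𝓡 m) ∞ M]
  {F : Type*} [TopologicalSpace F] [T2Space F] [SecondCountableTopology F]
  [ChartedSpace (EuclideanSpace ℝ (Fin p)) F] [IsManifold (𝓡 p) ∞ F]
  {N : Type*} [TopologicalSpace N]
  [ChartedSpace (EuclideanSpace ℝ (Fin n)) N] [IsManifold (𝓡 n) ∞ N]
  {π : C^∞⟮𝓡 p, F; 𝓡 m, M⟯}

/-- A smooth map `TF × ℝ → F` such that `t ↦ Ex (v, t)` is a curve in a fibre of `F`, starts at the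
base point of `v`, and, if `v` is vertical, has initial velocity `v`. The last property is stated
for Weil algebra valued tangent vectors. -/
theorem exists_vertical_curves (hπ : IsSmoothFiberBundle n N π)
    (W : Type*) [CommRing W] [Algebra ℝ W] [IsWeilAlgebra W] :
    ∃ Ex : C^∞⟮(𝓡 p).tangent.prod 𝓘(ℝ, ℝ), TangentBundle (𝓡 p) F × ℝ; 𝓡 p, F⟯,
      (∀ v, Ex (v, 0) = v.1) ∧ (∀ q, π (Ex q) = π q.1.1) ∧
      ∀ Z : SmoothFun (𝓡 p).tangent (TangentBundle (𝓡 p) F) →ₐ[ℝ] W,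
        (∀ h : SmoothFun (𝓡 m) M, Z (dFun (pullback π h)) = 0) →
        ∀ (f : SmoothFun (𝓡 p) F) (l : W →ₗ[ℝ] ℝ),
          HasDerivAt (fun t => l (Z ⟨fun v => f (Ex (v, t)), f.contMDiff.comp
            (Ex.contMDiff.comp (contMDiff_id.prodMk contMDiff_const))⟩)) (l (Z (dFun f))) 0 := by
  have : LocallyCompactSpace F := Manifold.locallyCompact_of_finiteDimensional (𝓡 p)
  rcases isEmpty_or_nonempty F with hF | hF
  · refine ⟨⟨fun q => q.1.1, (Bundle.contMDiff_proj _).comp contMDiff_fst⟩, fun _ => rfl,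
      fun _ => rfl, fun Z _ => ?_⟩
    obtain ⟨x, -⟩ := exists_tangent_basePoint Z
    exact isEmptyElim x
  choose U hU hxU hD using exists_verticalDisplacement hπ
  -- a countable cover and a subordinate partition of unity
  obtain ⟨s, hs, hsU⟩ := TopologicalSpace.countable_cover_nhds fun x => (hU x).mem_nhds (hxU x)
  have hsne : s.Nonempty := by
    rw [nonempty_iff_ne_empty]
    rintro rfl
    rw [biUnion_empty] at hsU
    exact empty_ne_univ hsU
  obtain ⟨c, rfl⟩ := hs.exists_eq_range hsne
  obtain ⟨ρ', hρ'⟩ := SmoothPartitionOfUnity.exists_isSubordinate (𝓡 p) isClosed_univ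
    (fun i => U (c i)) (fun i => hU _) (by rw [← hsU, biUnion_range])
  let ρ : ℕ → SmoothFun (𝓡 p) F := fun i => ρ' i
  have hDi : ∀ i, Nonempty (VerticalDisplacement n π (tsupport (ρ i))) := by
    intro i
    obtain ⟨θ, h0, h1, h01⟩ := exists_contMDiffMap_zero_one_nhds_of_isClosed (𝓡 p) (n := (⊤ : ℕ∞))
      (hU (c i)).isClosed_compl (isClosed_tsupport (ρ i))
      (disjoint_compl_left_iff_subset.2 (hρ' i))
    rw [eventually_nhdsSet_iff_forall] at h0 h1
    exact hD (c i) θ _ h01 h0 h1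
  let D := fun i => (hDi i).some
  -- locally, only finitely many displacements are non-trivial
  have hloc : ∀ x, ∃ k : ℕ, ∀ᶠ x' in 𝓝 x, ∀ i, k ≤ i → ρ i x' = 0 := by
    intro x
    obtain ⟨t, ht, hfin⟩ := ρ'.locallyFinite x
    obtain ⟨k, hk⟩ := hfin.bddAbove
    refine ⟨k + 1, ?_⟩
    filter_upwards [ht] with x' hx' i hi
    by_contra hne
    have := hk (show i ∈ {i | (Function.support (ρ' i) ∩ t).Nonempty} from ⟨x', hne, hx'⟩)
    omega
  choose k hk using hloc
  have hsum : ∀ x, ∀ᶠ x' in 𝓝 x, ∑ i ∈ Finset.range (k x), ρ i x' = 1 := by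
    intro x
    filter_upwards [hk x] with x' hx'
    rw [← ρ'.sum_eq_one (mem_univ x')]
    refine (finsum_eq_sum_of_support_subset _ fun i hi => ?_).symm
    by_contra hn
    exact hi (hx' i (by simpa using hn))
  have heq : ∀ x, ∀ᶠ x' in 𝓝 x, ∀ (v : TangentBundle (𝓡 p) F) (t : ℝ), v.1 = x' →
      curveSeq ρ D (k v.1) (v, t) = curveSeq ρ D (k x) (v, t) := by
    intro x
    filter_upwards [hk x] with x' hx' v t hv
    subst hv
    rcases le_total (k v.1) (k x) with h | h
    · exact (curveSeq_eq_of_le ρ D h (hk v.1).self_of_nhds).symm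
    · exact curveSeq_eq_of_le ρ D h hx'
  let Ex : C^∞⟮(𝓡 p).tangent.prod 𝓘(ℝ, ℝ), TangentBundle (𝓡 p) F × ℝ; 𝓡 p, F⟯ :=
    ⟨fun q => curveSeq ρ D (k q.1.1) q, fun q => by
      refine ((curveSeq ρ D (k q.1.1)).contMDiff q).congr_of_eventuallyEq ?_
      have hc : ContinuousAt (fun q : TangentBundle (𝓡 p) F × ℝ => q.1.1) q :=
        ((Bundle.contMDiff_proj (IB := 𝓡 p) (n := ∞) _).continuous.comp
          continuous_fst).continuousAt
      filter_upwards [hc.eventually (heq q.1.1)] with q' hq' using hq' q'.1 q'.2 rfl⟩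
  refine ⟨Ex, fun v => curveSeq_at_zero ρ D _ v, fun q => proj_curveSeq ρ D _ q,
    fun Z hZ f l => ?_⟩
  obtain ⟨x, hx⟩ := exists_tangent_basePoint Z
  have h := hasDerivAt_algHom_tangent Z
    ⟨fun q => f (curveSeq ρ D (k x) q), f.contMDiff.comp (curveSeq ρ D (k x)).contMDiff⟩
    (curveDeriv ρ D (k x) f) (hasDerivAt_curveSeq ρ D (k x) f) l
  rw [algHom_curveDeriv ρ D Z hZ hx (fun i => Subset.rfl) (hsum x)] at h
  refine h.congr_of_eventuallyEq (Eventually.of_forall fun t => ?_)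
  exact congrArg l (algHom_tangent_congr hx (heq x)
    fun v hv => congrArg f (hv v t rfl))

end VerticalExp

/-! ### Time derivatives and dual numbers -/

section TimeEval

variable {m : ℕ} {M : Type*} [TopologicalSpace M] [ChartedSpace (EuclideanSpace ℝ (Fin m)) M]
  {P : Type*} [NormedAddCommGroup P] [NormedSpace ℝ P]
  {W : Type*} [CommRing W] [Algebra ℝ W]

theorem pointEvalW_map_evalZero (τ : ParamFun m M (P × ℝ) ⊗[ℝ] W) (y : M × P) :
    pointEvalW ((𝓡 m).prod 𝓘(ℝ, P)) W y
        (Algebra.TensorProduct.map (evalZero m M P) (AlgHom.id ℝ W) τ) =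
      pointEvalW ((𝓡 m).prod 𝓘(ℝ, P × ℝ)) W (y.1, (y.2, 0)) τ := by
  induction τ with
  | zero => simp
  | add a b ha hb => simp only [map_add, ha, hb]
  | tmul f w => simp

variable [IsManifold (𝓡 m) ∞ M]

theorem hasDerivAt_pointEvalW (τ : ParamFun m M (P × ℝ) ⊗[ℝ] W) (y : M × P) (l : W →ₗ[ℝ] ℝ) :
    HasDerivAt (fun t : ℝ => l (pointEvalW ((𝓡 m).prod 𝓘(ℝ, P × ℝ)) W (y.1, (y.2, t)) τ))
      (l (pointEvalW ((𝓡 m).prod 𝓘(ℝ, P)) W y (tDeriv.rTensor W τ))) 0 := by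
  induction τ with
  | zero => simpa using hasDerivAt_const (0 : ℝ) (0 : ℝ)
  | add a b ha hb =>
    simp only [map_add]
    exact ha.add hb
  | tmul f w =>
    simp only [pointEvalW_tmul, LinearMap.rTensor_tmul, map_smul, smul_eq_mul, tDeriv_apply]
    exact (differentiable_line f y 0).hasDerivAt.mul_const _

theorem rTensor_tDeriv_mul (σ τ : ParamFun m M (P × ℝ) ⊗[ℝ] W) :
    tDeriv.rTensor W (σ * τ) =
      Algebra.TensorProduct.map (evalZero m M P) (AlgHom.id ℝ W) σ * tDeriv.rTensor W τ +
      tDeriv.rTensor W σ * Algebra.TensorProduct.map (evalZero m M P) (AlgHom.id ℝ W) τ := by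
  induction σ with
  | zero => simp
  | add a b ha hb =>
    simp only [add_mul, map_add, ha, hb]
    abel
  | tmul f w =>
    induction τ with
    | zero => simp
    | add a b ha hb =>
      simp only [mul_add, map_add, ha, hb]
      abel
    | tmul g w' =>
      simp only [Algebra.TensorProduct.tmul_mul_tmul, LinearMap.rTensor_tmul, tDeriv_mul,
        Algebra.TensorProduct.map_tmul, AlgHom.id_apply, TensorProduct.add_tmul]
      exact add_comm _ _

theorem rTensor_tDeriv_projPullback (h : SmoothFun (𝓡 m) M) :
    tDeriv.rTensor W (projPullback m M (P × ℝ) W h) = (0 : ParamFun m M P ⊗[ℝ] W) := by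
  have : tDeriv (pullback (projM m M (P × ℝ)) h) = (0 : ParamFun m M P) := by
    ext y
    exact deriv_const 0 (h y.1)
  simp [projPullback, this]

end TimeEval

section DualNumbers

variable {A B D W : Type*} [CommRing A] [Algebra ℝ A] [CommRing B] [Algebra ℝ B]
  [CommRing D] [Algebra ℝ D] [CommRing W] [Algebra ℝ W] {c₀ : D →ₐ[ℝ] ℝ} {c₁ : D →ₗ[ℝ] ℝ} {e : D}

variable (A W c₀) in
/-- The extension to `A ⊗ D ⊗ W` of an algebra homomorphism `D → ℝ`. For `D = ℝ[ε]/ε²` this is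
the coefficient of `1`. -/
noncomputable def tensorFst : A ⊗[ℝ] (D ⊗[ℝ] W) →ₐ[ℝ] A ⊗[ℝ] W :=
  Algebra.TensorProduct.map (AlgHom.id ℝ A)
    ((Algebra.TensorProduct.lid ℝ W).toAlgHom.comp
      (Algebra.TensorProduct.map c₀ (AlgHom.id ℝ W)))

variable (A W c₁) in
/-- The extension to `A ⊗ D ⊗ W` of a linear functional on `D`. For `D = ℝ[ε]/ε²` it is used
with the coefficient of `ε`. -/
noncomputable def tensorSnd : A ⊗[ℝ] (D ⊗[ℝ] W) →ₗ[ℝ] A ⊗[ℝ] W :=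
  ((TensorProduct.lid ℝ W).toLinearMap ∘ₗ c₁.rTensor W).lTensor A

@[simp] theorem tensorFst_tmul (a : A) (d : D) (w : W) :
    tensorFst A W c₀ (a ⊗ₜ (d ⊗ₜ w)) = a ⊗ₜ (c₀ d • w) := by
  simp [tensorFst]

@[simp] theorem tensorSnd_tmul (a : A) (d : D) (w : W) :
    tensorSnd A W c₁ (a ⊗ₜ (d ⊗ₜ w)) = a ⊗ₜ (c₁ d • w) := by
  simp [tensorSnd]

/-- Induction on the elements of a threefold tensor product. -/
theorem tensor_induction {p : A ⊗[ℝ] (D ⊗[ℝ] W) → Prop} (zero : p 0)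
    (tmul : ∀ a d w, p (a ⊗ₜ (d ⊗ₜ w))) (add : ∀ x y, p x → p y → p (x + y)) (x) : p x := by
  induction x with
  | zero => exact zero
  | add x y hx hy => exact add x y hx hy
  | tmul a z =>
    induction z with
    | zero => rwa [TensorProduct.tmul_zero]
    | add x y hx hy =>
      rw [TensorProduct.tmul_add]
      exact add _ _ hx hy
    | tmul d w => exact tmul a d w

theorem tensorSnd_mul (hc : ∀ d d', c₁ (d * d') = c₀ d * c₁ d' + c₁ d * c₀ d')
    (x y : A ⊗[ℝ] (D ⊗[ℝ] W)) :
    tensorSnd A W c₁ (x * y) =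
      tensorFst A W c₀ x * tensorSnd A W c₁ y + tensorSnd A W c₁ x * tensorFst A W c₀ y := by
  induction x using tensor_induction with
  | zero => simp
  | add a b ha hb =>
    simp only [add_mul, map_add, ha, hb]
    abel
  | tmul a d w =>
    induction y using tensor_induction with
    | zero => simp
    | add a b ha hb =>
      simp only [mul_add, map_add, ha, hb]
      abel
    | tmul a' d' w' =>
      simp only [Algebra.TensorProduct.tmul_mul_tmul, tensorFst_tmul, tensorSnd_tmul,
        smul_mul_smul_comm, ← TensorProduct.tmul_add, ← add_smul, hc]

theorem tensorFst_tensorSnd_ext (he : ∀ d, d = c₀ d • 1 + c₁ d • e) {x y : A ⊗[ℝ] (D ⊗[ℝ] W)}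
    (h0 : tensorFst A W c₀ x = tensorFst A W c₀ y)
    (h1 : tensorSnd A W c₁ x = tensorSnd A W c₁ y) : x = y := by
  have key : ∀ x : A ⊗[ℝ] (D ⊗[ℝ] W),
      x = (TensorProduct.mk ℝ D W 1).lTensor A (tensorFst A W c₀ x) +
        (TensorProduct.mk ℝ D W e).lTensor A (tensorSnd A W c₁ x) := by
    intro x
    induction x using tensor_induction with
    | zero => simp
    | add a b ha hb =>
      conv_lhs => rw [ha, hb]
      simp only [map_add]
      abel
    | tmul a d w =>
      conv_lhs => rw [he d]
      simp only [tensorFst_tmul, tensorSnd_tmul, LinearMap.lTensor_tmul,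
        TensorProduct.mk_apply, TensorProduct.add_tmul, TensorProduct.tmul_add,
        TensorProduct.smul_tmul]
  rw [key x, key y, h0, h1]

variable {T : B →ₐ[ℝ] A ⊗[ℝ] D} {E₀ : B →ₐ[ℝ] A} {E₁ : B →ₗ[ℝ] A}

theorem tensorFst_assoc_map (hT : ∀ f, T f = E₀ f ⊗ₜ 1 + E₁ f ⊗ₜ e) (h0 : c₀ e = 0)
    (τ : B ⊗[ℝ] W) :
    tensorFst A W c₀ (Algebra.TensorProduct.assoc ℝ ℝ ℝ A D W
        (Algebra.TensorProduct.map T (AlgHom.id ℝ W) τ)) =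
      Algebra.TensorProduct.map E₀ (AlgHom.id ℝ W) τ := by
  induction τ with
  | zero => simp
  | add a b ha hb => simp only [map_add, ha, hb]
  | tmul f w => simp [hT, TensorProduct.add_tmul, h0]

theorem tensorSnd_assoc_map (hT : ∀ f, T f = E₀ f ⊗ₜ 1 + E₁ f ⊗ₜ e) (h1 : c₁ 1 = 0)
    (he : c₁ e = 1) (τ : B ⊗[ℝ] W) :
    tensorSnd A W c₁ (Algebra.TensorProduct.assoc ℝ ℝ ℝ A D W
        (Algebra.TensorProduct.map T (AlgHom.id ℝ W) τ)) = E₁.rTensor W τ := by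
  induction τ with
  | zero => simp
  | add a b ha hb => simp only [map_add, ha, hb]
  | tmul f w => simp [hT, TensorProduct.add_tmul, h1, he]

end DualNumbers

/-! ### Plots of vertical fields as derivations, and as velocities of paths -/

section PlotsComparison

variable {m p : ℕ}
  {M : Type*} [TopologicalSpace M] [T2Space M]
  [ChartedSpace (EuclideanSpace ℝ (Fin m)) M] [IsManifold (𝓡 m) ∞ M]
  {F : Type*} [TopologicalSpace F] [T2Space F] [SecondCountableTopology F]
  [ChartedSpace (EuclideanSpace ℝ (Fin p)) F] [IsManifold (𝓡 p) ∞ F]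
  {π : C^∞⟮𝓡 p, F; 𝓡 m, M⟯} {P : Type*} [NormedAddCommGroup P] [NormedSpace ℝ P]
  {W : Type*} [CommRing W] [Algebra ℝ W] [IsWeilAlgebra W]

omit [T2Space M] [T2Space F] [SecondCountableTopology F] in
theorem pullback_tangentDiff_dFun (h : SmoothFun (𝓡 m) M) :
    pullback (tangentDiff π) (dFun h) = dFun (pullback π h) := by
  ext v
  have hh : MDifferentiableAt (𝓡 m) 𝓘(ℝ, ℝ) h (π v.1) :=
    (h.contMDiff _).mdifferentiableAt (by simp)
  have hπ : MDifferentiableAt (𝓡 p) (𝓡 m) π v.1 :=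
    (π.contMDiff _).mdifferentiableAt (by simp)
  exact congrArg (fun L => L v.2) (mfderiv_comp v.1 hh hπ).symm

omit [T2Space M] in
theorem pullback_tangentZero_dFun (h : SmoothFun (𝓡 m) M) :
    pullback (tangentZero m M) (dFun h) = 0 := by
  ext x
  exact map_zero (mfderiv (𝓡 m) 𝓘(ℝ, ℝ) h x)

/-- A derivation along a plot of fields that kills the functions from the base is a plot of
vertical fields. -/
theorem exists_verticalPlot [SecondCountableTopology M] (a : FieldPlot π P W)
    (b : SmoothFun (𝓡 p) F →ₗ[ℝ] ParamFun m M P ⊗[ℝ] W)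
    (hb : ∀ f g, b (f * g) = a.hom f * b g + b f * a.hom g)
    (hb0 : ∀ h, b (pullback π h) = 0) :
    ∃ Z : VerticalPlot π P W, Z.base = a ∧ ∀ f, Z.hom (dFun f) = b f := by
  have : Module.Finite ℝ W := IsWeilAlgebra.finite
  let ev := fun y => pointEvalW ((𝓡 m).prod 𝓘(ℝ, P)) (Y := M × P) W y
  choose Z h0 h1 using fun y => exists_algHom_tangent ((ev y).comp a.hom)
    ((ev y).toLinearMap ∘ₗ b) fun f g => by
      change ev y (b (f * g)) = ev y (a.hom f) * ev y (b g) + ev y (b f) * ev y (a.hom g)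
      rw [hb, map_add, map_mul, map_mul]
  have hs : ∀ f y, WeakSmoothAt ((𝓡 m).prod 𝓘(ℝ, P)) (fun z => Z z f) y := by
    intro f y
    have h := weakSmoothAt_family_tangent (Z := Z)
      (fun f y => by simp only [h0]; exact weakSmoothAt_pointEvalW (a.hom f) y)
      (fun f y => by simp only [h1]; exact weakSmoothAt_pointEvalW (b f) y)
      ⟨fun q => f q.1, f.contMDiff.comp contMDiff_fst⟩ (y, 0)
    exact h.comp (g := fun y : M × P => (y, (0 : ℝ)))
      (contMDiffAt_id.prodMk contMDiffAt_const)
  obtain ⟨z, hz⟩ := exists_algHom_of_family Z hs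
  refine ⟨⟨z, ?_⟩, ?_, fun f => pointEvalW_ext fun y => (hz y _).trans (h1 y f)⟩
  · refine AlgHom.ext fun g => pointEvalW_ext fun y => ?_
    refine DFunLike.congr_fun (algHom_tangent_ext
      (Z := (ev y).comp (z.comp (pullback (tangentDiff π))))
      (Z' := (ev y).comp ((projPullback m M P W).comp (pullback (tangentZero m M))))
      (fun f => ?_) fun f => ?_) g
    · have e := DFunLike.congr_fun a.hom_comp f
      refine (hz y _).trans ((h0 y (pullback π f)).trans (congrArg (ev y) e))
    · simp only [AlgHom.comp_apply, pullback_tangentDiff_dFun, pullback_tangentZero_dFun, map_zero]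
      refine (hz y _).trans ((h1 y (pullback π f)).trans ?_)
      change ev y (b _) = 0
      rw [hb0, map_zero]
  · ext f
    exact pointEvalW_ext fun y => (hz y _).trans (h0 y f)

omit [T2Space M] in
theorem VerticalPlot.ext_of_base_of_dFun {Z Z' : VerticalPlot π P W} (h0 : Z.base = Z'.base)
    (h1 : ∀ f, Z.hom (dFun f) = Z'.hom (dFun f)) : Z = Z' := by
  have : Module.Finite ℝ W := IsWeilAlgebra.finite
  ext g
  refine pointEvalW_ext fun y => DFunLike.congr_fun (algHom_tangent_ext
    (Z := (pointEvalW _ W y).comp Z.hom) (Z' := (pointEvalW _ W y).comp Z'.hom)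
    (fun f => ?_) fun f => congrArg _ (h1 f)) g
  exact congrArg (pointEvalW _ W y) (DFunLike.congr_fun (congrArg FieldPlot.hom h0) f)

/-- The initial velocity of a path of plots exists and is unique. -/
theorem FieldPlot.existsUnique_hasTDerivAtZero [SecondCountableTopology M] (Φ : PathPlot π P W) :
    ∃! Z : VerticalPlot π P W, Φ.HasTDerivAtZero Z := by
  obtain ⟨Z, h0, h1⟩ := exists_verticalPlot Φ.atZero (tDeriv.rTensor W ∘ₗ Φ.hom.toLinearMap)
    (fun f g => by
      change tDeriv.rTensor W (Φ.hom (f * g)) = _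
      rw [map_mul, rTensor_tDeriv_mul]
      rfl)
    fun h => by
      change tDeriv.rTensor W (Φ.hom.comp (pullback π) h) = 0
      rw [Φ.hom_comp, rTensor_tDeriv_projPullback]
  exact ⟨Z, ⟨h0, h1⟩, fun Z' h => VerticalPlot.ext_of_base_of_dFun (h.1.trans h0.symm)
    fun f => (h.2 f).trans (h1 f).symm⟩

/-- Each plot of vertical fields is the initial velocity of a path of plots: move along the curves
of `exists_vertical_curves`. -/
theorem VerticalPlot.exists_path {n : ℕ} {N : Type*} [TopologicalSpace N]
    [ChartedSpace (EuclideanSpace ℝ (Fin n)) N] [IsManifold (𝓡 n) ∞ N]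
    (hπ : IsSmoothFiberBundle n N π) (Z : VerticalPlot π P W) :
    ∃ Φ : PathPlot π P W, Φ.HasTDerivAtZero Z := by
  have : Module.Finite ℝ W := IsWeilAlgebra.finite
  obtain ⟨Ex, hEx0, hExπ, hEx⟩ := exists_vertical_curves hπ W
  let ev := fun y => pointEvalW ((𝓡 m).prod 𝓘(ℝ, P)) (Y := M × P) W y
  let move : ℝ → C^∞⟮(𝓡 p).tangent, TangentBundle (𝓡 p) F; 𝓡 p, F⟯ := fun t =>
    ⟨fun v => Ex (v, t), Ex.contMDiff.comp (contMDiff_id.prodMk contMDiff_const)⟩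
  have hs : ∀ f (q : M × (P × ℝ)), WeakSmoothAt ((𝓡 m).prod 𝓘(ℝ, P × ℝ))
      (fun q : M × (P × ℝ) => ((ev (q.1, q.2.1)).comp (Z.hom.comp (pullback (move q.2.2)))) f)
      q := by
    intro f q
    have h := weakSmoothAt_family_tangent (Z := fun y => (ev y).comp Z.hom)
      (fun f y => weakSmoothAt_pointEvalW _ y) (fun f y => weakSmoothAt_pointEvalW _ y)
      ⟨fun q => f (Ex q), f.contMDiff.comp Ex.contMDiff⟩ ((q.1, q.2.1), q.2.2)
    have h1 : ContMDiff ((𝓡 m).prod 𝓘(ℝ, P × ℝ)) 𝓘(ℝ, P) ∞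
        (fun q : M × (P × ℝ) => q.2.1) := contDiff_fst.contMDiff.comp contMDiff_snd
    have h2 : ContMDiff ((𝓡 m).prod 𝓘(ℝ, P × ℝ)) 𝓘(ℝ, ℝ) ∞
        (fun q : M × (P × ℝ) => q.2.2) := contDiff_snd.contMDiff.comp contMDiff_snd
    exact h.comp (g := fun q : M × (P × ℝ) => ((q.1, q.2.1), q.2.2))
      (((contMDiff_fst.prodMk h1).prodMk h2) q)
  obtain ⟨φ, hφ⟩ := exists_algHom_of_family _ hs
  refine ⟨⟨φ, ?_⟩, ?_, fun f => pointEvalW_ext fun y => ?_⟩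
  · refine AlgHom.ext fun h => pointEvalW_ext fun q => (hφ q _).trans ?_
    have e : pullback (move q.2.2) (pullback π h) =
        pullback (tangentProj p F) (pullback π h) := by
      ext v
      exact congrArg h (hExπ (v, q.2.2))
    have e' := DFunLike.congr_fun Z.base.hom_comp h
    change ev _ (Z.hom (pullback (move q.2.2) (pullback π h))) = _
    rw [e]
    refine (congrArg (ev _) e').trans ?_
    simp [ev, projPullback]
    rfl
  · ext f
    refine pointEvalW_ext fun y => ?_
    have e : pullback (move 0) f = pullback (tangentProj p F) f := by
      ext v
      exact congrArg f (hEx0 v)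
    refine Eq.trans ?_ ((pointEvalW_map_evalZero (φ f) y).trans (hφ _ f)).symm
    simp only [AlgHom.comp_apply, e]
    rfl
  · rw [← sub_eq_zero, ← Module.forall_dual_apply_eq_zero_iff ℝ]
    intro l
    rw [map_sub, sub_eq_zero]
    have h := hEx ((ev y).comp Z.hom) (fun h => ?_) f l
    · refine h.unique ?_
      exact (hasDerivAt_pointEvalW (φ f) y l).congr_of_eventuallyEq
        (Eventually.of_forall fun t => congrArg l (hφ (y.1, (y.2, t)) f).symm)
    · have e := DFunLike.congr_fun Z.hom_comp (dFun h)
      rw [AlgHom.comp_apply, AlgHom.comp_apply, pullback_tangentZero_dFun, map_zero,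
        pullback_tangentDiff_dFun] at e
      rw [AlgHom.comp_apply, e, map_zero]

/-- A plot `ψ` of the synthetic tangent bundle is `a + ε b` with a plot of fields `a` and a
derivation `b` along `a`, which is a plot of vertical fields. A path with this initial velocity
restricts to `ψ`. -/
theorem FieldPlot.restrictInfinitesimal_surjective [SecondCountableTopology M]
    {n : ℕ} {N : Type*} [TopologicalSpace N]
    [ChartedSpace (EuclideanSpace ℝ (Fin n)) N] [IsManifold (𝓡 n) ∞ N]
    (hπ : IsSmoothFiberBundle n N π) :
    Function.Surjective (FieldPlot.restrictInfinitesimal : PathPlot π P W → TangentPlot π P W) := by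
  intro ψ
  let c₀ : DualNumber ℝ →ₐ[ℝ] ℝ := TrivSqZeroExt.fstHom ℝ ℝ ℝ
  let c₁ : DualNumber ℝ →ₗ[ℝ] ℝ := TrivSqZeroExt.sndHom ℝ ℝ
  have hc : ∀ d d', c₁ (d * d') = c₀ d * c₁ d' + c₁ d * c₀ d' := fun d d' =>
    (TrivSqZeroExt.snd_mul d d').trans (by simp [c₀, c₁, mul_comm])
  have hψ : ∀ h, ψ.hom (pullback π h) = pullback (projM m M P) h ⊗ₜ[ℝ] (1 ⊗ₜ[ℝ] 1) :=
    DFunLike.congr_fun ψ.hom_comp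
  obtain ⟨Z, h0, h1⟩ := exists_verticalPlot
    ⟨(tensorFst _ W c₀).comp ψ.hom, AlgHom.ext fun h => by
      change tensorFst _ W c₀ (ψ.hom (pullback π h)) = _
      rw [hψ, tensorFst_tmul, map_one, one_smul]
      rfl⟩
    (tensorSnd _ W c₁ ∘ₗ ψ.hom.toLinearMap)
    (fun f g => by
      change tensorSnd _ W c₁ (ψ.hom (f * g)) = _
      rw [map_mul, tensorSnd_mul hc]
      rfl)
    fun h => by
      change tensorSnd _ W c₁ (ψ.hom (pullback π h)) = 0
      rw [hψ, tensorSnd_tmul, show c₁ 1 = 0 from rfl, zero_smul, TensorProduct.tmul_zero]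
  obtain ⟨Φ, hΦ0, hΦ1⟩ := Z.exists_path hπ
  have hT : ∀ f, taylor m M P f = evalZero m M P f ⊗ₜ 1 + tDeriv f ⊗ₜ DualNumber.eps :=
    fun _ => rfl
  refine ⟨Φ, FieldPlot.ext (AlgHom.ext fun f =>
    tensorFst_tensorSnd_ext (c₀ := c₀) (c₁ := c₁) (e := DualNumber.eps) (fun d => ?_) ?_ ?_)⟩
  · ext <;> simp [c₀, c₁]
  · refine (tensorFst_assoc_map hT rfl (Φ.hom f)).trans ?_
    exact DFunLike.congr_fun (congrArg FieldPlot.hom (hΦ0.symm.trans h0)) f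
  · exact (tensorSnd_assoc_map hT rfl rfl (Φ.hom f)).trans ((hΦ1 f).symm.trans (h1 f))

end PlotsComparison

theorem mainTheorem8 {m n p : ℕ}
    {M : Type*} [TopologicalSpace M] [T2Space M] [SecondCountableTopology M]
    [ChartedSpace (EuclideanSpace ℝ (Fin m)) M] [IsManifold (𝓡 m) ∞ M]
    {F : Type*} [TopologicalSpace F] [T2Space F] [SecondCountableTopology F]
    [ChartedSpace (EuclideanSpace ℝ (Fin p)) F] [IsManifold (𝓡 p) ∞ F]
    {N : Type*} [TopologicalSpace N] [T2Space N] [SecondCountableTopology N]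
    [ChartedSpace (EuclideanSpace ℝ (Fin n)) N] [IsManifold (𝓡 n) ∞ N]
    (π : C^∞⟮𝓡 p, F; 𝓡 m, M⟯) (hπ : IsSmoothFiberBundle n N π)
    (k : ℕ) (W : Type*) [CommRing W] [Algebra ℝ W] [IsWeilAlgebra W] :
    (∀ Z : VerticalPlot π (EuclideanSpace ℝ (Fin k)) W,
      ∃ Φ : PathPlot π (EuclideanSpace ℝ (Fin k)) W,
        Φ.atZero = Z.base ∧ Φ.HasTDerivAtZero Z) ∧
    (∀ Φ : PathPlot π (EuclideanSpace ℝ (Fin k)) W,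
      ∃! Z : VerticalPlot π (EuclideanSpace ℝ (Fin k)) W, Φ.HasTDerivAtZero Z) ∧
    Function.Surjective
      (FieldPlot.restrictInfinitesimal :
        PathPlot π (EuclideanSpace ℝ (Fin k)) W →
          TangentPlot π (EuclideanSpace ℝ (Fin k)) W) := by
  refine ⟨fun Z => ?_, fun Φ => Φ.existsUnique_hasTDerivAtZero,
    FieldPlot.restrictInfinitesimal_surjective hπ⟩
  obtain ⟨Φ, hΦ⟩ := Z.exists_path hπ
  exact ⟨Φ, hΦ.1.symm, hΦ⟩
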